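/- Conventions. A compact imbedded $d$-manifold $\mathcal M\subset\mathbb R^n$ is a compact set for which there are $r_1>r_2>0$ such that for each $z\in\mathcal M$ the set $\mathcal M\cap B(z,r_2)$ is the intersection with $B(z,r_2)$ of $\{z+x+\Psi(x): x\in T,\ \|x\|<r_1\}$, for some $d$-dimensional subspace $T=T_z\mathcal M$ (the tangent space) and some $C^2$ map $\Psi$ from the ball of radius $r_1$ in $T$ to $T^\perp$ with $\Psi(0)=0$ and $D\Psi(0)=0$. $V$ denotes its $d$-dimensional volume, and its reach is the largest $\rho\in[0,\infty]$ such that every point at distance less than $\rho$ from $\mathcal M$ has a unique closest point on $\mathcal M$. A cylinder (of size $\bar\tau$) with center $x$ and direction $W$ ($W$ a $d$-dimensional subspace of $\mathbb R^n$, $P_W$ the orthogonal projection onto $W$) is $\{y:\|P_W(y-x)\|\le\bar\tau,\ \|(y-x)-P_W(y-x)\|\le\bar\tau\}$; its central cross-section is the disc $\{x+w: w\in W,\ \|w\|\le\bar\tau\}$, contained in the plane $x+W$. A collection of cylinders $\mathrm{cyl}_1,\dots,\mathrm{cyl}_m$ of size $\bar\tau$ with centers $x_i$ and directions $W_i$ is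 a *cylinder packet with constant $A$* (relative to $V,\tau,\bar\tau$) if 1. $m\le A\,V/\bar\tau^{\,d}$; 2. for each $i$, with $S_i$ the set of $j\ne i$ such that $\mathrm{cyl}_j$ intersects $\mathrm{cyl}_i$, there are for each $j\in S_i$ a proper rotation $U_j$ about $x_j$ (an orientation-preserving isometry of $\mathbb R^n$ fixing $x_j$) and a translation $Tr_j$ such that (a) $Tr_jU_j\,\mathrm{cyl}_j$ is a translate of $\mathrm{cyl}_i$ by a vector of norm at least $\bar\tau/3$, for all $j\in S_i$; (b) the points of $\{x_i\}\cup\{Tr_jU_jx_j: j\in S_i\}$ lie in the plane $x_i+W_i$, and every point of the central cross-section of $\mathrm{cyl}_i$ is at distance less than $\bar\tau/2$ from one of them; (c) $\|v-U_jv\|<2A\frac{\bar\tau}{\tau}\|v-x_j\|$ for all $j\in S_i$ and all $v\in\mathbb R^n$ with $v\ne x_j$; (d) $\|Tr_j(0)\|<A\frac{\bar\tau^2}{\tau}$ for all $j\in S_i$. **Corollary (admissible cylinder packets).** For every $d$ and every constant $K$ there are constants $c,A>0$, depending only on $d$ and $K$, such that the following holds. Let $\mathcal M$ be a compact imbedded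 $d$-manifold in some $\mathbb R^n$, let $\tau>0$ be its reach (or any positive number not exceeding the reach), let $V$ be its $d$-dimensional volume, and let $0<\bar\tau\le c\,\tau$. Let $x_1,\dots,x_m\in\mathcal M$ form a $\bar\tau/2$-net of $\mathcal M$ (every point of $\mathcal M$ is at distance less than $\bar\tau/2$ from some $x_i$) with $\|x_i-x_j\|\ge\bar\tau/2.9$ for $i\ne j$. Then every collection of cylinders of size $\bar\tau$ with centers $x_1,\dots,x_m$ and directions $W_1,\dots,W_m$ such that $$\|P_{W_i}-P_{T_{x_i}\mathcal M}\|_{\mathrm{op}}\le K\,\frac{\bar\tau}{\tau}\qquad(1\le i\le m)$$ is a cylinder packet with constant $A$. (It is called an admissible cylinder packet.) -/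

import Mathlib

open MeasureTheory
open scoped ENNReal Topology

noncomputable section

/-- Euclidean space `ℝⁿ` with its Euclidean norm. -/
abbrev Euc (n : ℕ) : Type := EuclideanSpace ℝ (Fin n)

/-- The patch `{z + x + Ψ(x) : x ∈ T, ‖x‖ < r}` of radius `r` over the subspace `T`, centered
at `z`. -/
def patch {n : ℕ} (z : Euc n) (T : Submodule ℝ (Euc n)) (r : ℝ) (Ψ : T → Tᗮ) : Set (Euc n) :=
  {p | ∃ x : T, ‖x‖ < r ∧ p = z + (x : Euc n) + (Ψ x : Euc n)}

/-- Compact imbedded `d`-manifolds in `ℝⁿ` (of class `C²`, without boundary): compact sets that,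
in balls of a uniform radius about each of their points `z`, coincide with a `C²` patch over a
`d`-dimensional subspace `T`, centered at `z` and tangent to `T` there. -/
def IsCompactImbeddedManifold {n : ℕ} (d : ℕ) (M : Set (Euc n)) : Prop :=
  IsCompact M ∧
    ∃ r₁ r₂ : ℝ, 0 < r₂ ∧ r₂ < r₁ ∧
      ∀ z ∈ M, ∃ T : Submodule ℝ (Euc n), Module.finrank ℝ T = d ∧
        ∃ Ψ : T → Tᗮ, ContDiffOn ℝ 2 Ψ (Metric.ball 0 r₁) ∧ Ψ 0 = 0 ∧ fderiv ℝ Ψ 0 = 0 ∧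
          M ∩ Metric.ball z r₂ = patch z T r₁ Ψ ∩ Metric.ball z r₂

/-- The (linear) tangent space of `M` at `z`, spanned by the limits of rescaled secant directions
at `z`. -/
def tangentSpaceOf {n : ℕ} (M : Set (Euc n)) (z : Euc n) : Submodule ℝ (Euc n) :=
  Submodule.span ℝ (tangentConeAt ℝ M z)

/-- The reach of `M`: the largest `r ∈ [0, ∞]` such that every point at distance less than `r`
from `M` has a unique closest point on `M`. -/
def reach {n : ℕ} (M : Set (Euc n)) : ℝ≥0∞ :=
  sSup {r : ℝ≥0∞ | ∀ p : Euc n, Metric.infEDist p M < r →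
    ∃! q : Euc n, q ∈ M ∧ edist p q = Metric.infEDist p M}

/-- `Y` is an `η`-net for `A`. -/
def IsNetFor {n : ℕ} (η : ℝ) (Y A : Set (Euc n)) : Prop :=
  Y ⊆ A ∧ ∀ p ∈ A, ∃ y ∈ Y, ‖p - y‖ < η

/-- The position of a cylinder in `ℝⁿ` with a `d`-dimensional central cross-section: its center
and the linear subspace parallel to the central cross-section. The size is a separate
parameter. -/
structure Cylinder (n d : ℕ) where
  center : Euc n
  dir : Submodule ℝ (Euc n)
  finrank_dir : Module.finrank ℝ dir = d

namespace Cylinder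

variable {n d : ℕ}

/-- The solid cylinder: an isometric copy of `r (B_d × B_{n-d})`, whose `d`-dimensional factor
is parallel to `c.dir`. -/
def solid (c : Cylinder n d) (r : ℝ) : Set (Euc n) :=
  {p | ‖c.dir.starProjection (p - c.center)‖ ≤ r ∧
    ‖(p - c.center) - c.dir.starProjection (p - c.center)‖ ≤ r}

/-- The `d`-dimensional central cross-section, a closed `d`-dimensional disc of radius `r`. -/
def crossSection (c : Cylinder n d) (r : ℝ) : Set (Euc n) :=
  {p | p - c.center ∈ c.dir ∧ ‖p - c.center‖ ≤ r}

/-- The `d`-dimensional affine plane that contains the central cross-section. -/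
def plane (c : Cylinder n d) : Set (Euc n) :=
  {p | p - c.center ∈ c.dir}

/-- `Tr U v`, where `U` is the rotation with linear part `R` that fixes the center of `c`, and
`Tr` is the translation by `t = Tr(0)`. -/
def move (c : Cylinder n d) (R : Euc n ≃ₗᵢ[ℝ] Euc n) (t : Euc n) (v : Euc n) : Euc n :=
  (c.center + R (v - c.center)) + t

end Cylinder

/-- The indices `j ≠ i` of the other cylinders of the collection that intersect the `i`-th one. -/
def intersecting {n d m : ℕ} (r : ℝ) (C : Fin m → Cylinder n d) (i : Fin m) : Set (Fin m) :=
  {j | j ≠ i ∧ ((C j).solid r ∩ (C i).solid r).Nonempty}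

/-- `C` is a packet of cylinders of size `r` for a manifold of volume `V` and reach `τ`, with
constant `A`. The conditions do not depend on the choice of coordinates, so that the rigid motion
to coordinates adapted to the `i`-th cylinder is left out (up to conjugating `R j` and rotating
`t j` it changes nothing). -/
structure IsCylinderPacket {n d m : ℕ} (A : ℝ) (V : ℝ≥0∞) (τ r : ℝ)
    (C : Fin m → Cylinder n d) : Prop where
  card_le : (m : ℝ≥0∞) ≤ ENNReal.ofReal (A / r ^ d) * V
  exists_motions : ∀ i : Fin m,
    ∃ (R : Fin m → (Euc n ≃ₗᵢ[ℝ] Euc n)) (t : Fin m → Euc n),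
      -- the rotations are proper
      (∀ j ∈ intersecting r C i, LinearMap.det ((R j).toLinearEquiv : Euc n →ₗ[ℝ] Euc n) = 1) ∧
      -- each moved cylinder is a translate of the `i`-th one by a vector of norm at least `r / 3`
      (∀ j ∈ intersecting r C i, ∃ w : Euc n, r / 3 ≤ ‖w‖ ∧
        (C j).move (R j) (t j) '' (C j).solid r = (fun v => v + w) '' (C i).solid r) ∧
      -- the `i`-th center and the moved centers lie in the plane of the `i`-th cross-section, and
      -- every point of that cross-section is at distance less than `r / 2` from one of them
      (insert (C i).center
          ((fun j => (C j).move (R j) (t j) (C j).center) '' intersecting r C i) ⊆ (C i).plane ∧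
        ∀ q ∈ (C i).crossSection r, ∃ y ∈ insert (C i).center
            ((fun j => (C j).move (R j) (t j) (C j).center) '' intersecting r C i),
          ‖q - y‖ < r / 2) ∧
      -- the rotations are close to the identity
      (∀ j ∈ intersecting r C i, ∀ v : Euc n, v ≠ (C j).center →
        ‖v - (C j).move (R j) 0 v‖ < A * (2 * (r / τ) * ‖v - (C j).center‖)) ∧
      -- the translations are small
      (∀ j ∈ intersecting r C i, ‖t j‖ < A * (r ^ 2 / τ))

end

/-!
Write `P_W` for the orthogonal projection onto a subspace `W`, and `T_x` for the tangent space of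
`M` at `x`. The natural candidates for the moved centers are `x_i + P_{W_i} (x_j - x_i)`, and the
rotation `U_j` should carry `W_j` to `W_i`. All the conditions on a packet then follow from two
facts about manifolds of reach at least `τ` and one about pairs of subspaces.

* Points of `M` are close to tangent planes: the component of `q - x` normal to `T_x` is at most
  `‖q - x‖² / τ` (`norm_sub_starProjection_le`). Every normal vector at `x` points to centers of
  small balls that touch `M` at `x` from outside, and such a ball can be enlarged up to the reach:
  the maximum of the distance to `M` over a ball about the center `x₀` is attained on the line
  from `x` through `x₀` (`nearest_extend`). This argument needs only the uniqueness of nearest points, no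
  differentiability of the distance.
* Tangent spaces are Lipschitz: `‖P_{T_x} - P_{T_y}‖ ≤ 110 ‖x - y‖ / τ`
  (`norm_starProjection_tangent_sub_le`). A differential inequality for the distance to `M` along
  a tangent ray shows that `x + u` is within `5 ‖u‖² / τ` of `M` for `u ∈ T_x`
  (`infDist_add_tangent_le`). The point of `M` near `x + u` is also close to the tangent plane at
  `y`, so that `u` is nearly in `T_y`.
* If `‖P_W - P_{W'}‖ ≤ ε < 1`, a proper rotation at distance at most `2 ε` from the identity,
  whatever the dimension of the ambient space, carries `W` to `W'`
  (`Submodule.exists_rotation_of_norm_starProjection_sub_le`).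

The projection to a nearly tangent plane maps a neighbourhood of `x` in `M` onto a set that
contains a disc
(`exists_starProjection_eq`). Since projections do not increase distances, the net property passes
from `M` to the central cross-section with the same radius `r / 2`, without loss. Since they do not
increase volume, the part of `M` in a ball of radius `r / 5.8` about a center has volume at least
that of a `d`-dimensional ball of radius `r / 6`; these balls are disjoint, which bounds the number
of cylinders (`card_le_of_separated`).
-/

/-! ### Rotations between nearby subspaces -/

section Rotation

variable {E : Type*} [NormedAddCommGroup E] [InnerProductSpace ℝ E] [FiniteDimensional ℝ E]

/-- A linear isometry that moves no vector to its opposite is joined to the identity by the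
segment `(1 - t) + t R` of invertible maps, so its determinant is positive. -/
theorem LinearIsometryEquiv.det_eq_one_of_forall_ne_neg (R : E ≃ₗᵢ[ℝ] E)
    (hR : ∀ v, v ≠ 0 → R v ≠ -v) :
    LinearMap.det (R.toLinearEquiv : E →ₗ[ℝ] E) = 1 := by
  set f : ℝ → ℝ := fun t =>
    LinearMap.det ((1 - t) • (LinearMap.id : E →ₗ[ℝ] E) + t • (R.toLinearEquiv : E →ₗ[ℝ] E)) with hf
  have hcont : Continuous f := by
    have hf' : f = fun t => ((1 - t) • ContinuousLinearMap.id ℝ E +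
        t • (R : E →L[ℝ] E)).det := rfl
    rw [hf']
    exact ContinuousLinearMap.continuous_det.comp (by fun_prop)
  have hne : ∀ t ∈ Set.Icc (0 : ℝ) 1, f t ≠ 0 := by
    intro t ht h0
    obtain ⟨v, hv, hv0⟩ := Submodule.exists_mem_ne_zero_of_ne_bot
      (LinearMap.bot_lt_ker_of_det_eq_zero h0).ne'
    have h1 : (1 - t) • v + t • R v = 0 := by simpa using hv
    have h2 : t • R v = -((1 - t) • v) := by rw [eq_neg_iff_add_eq_zero, add_comm]; exact h1
    have h3 : t * ‖v‖ = (1 - t) * ‖v‖ := by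
      have := congrArg norm h2
      rwa [norm_neg, norm_smul, norm_smul, R.norm_map, Real.norm_of_nonneg ht.1,
        Real.norm_of_nonneg (by linarith [ht.2])] at this
    have h4 : t = 1 / 2 := by
      have := mul_right_cancel₀ (norm_ne_zero_iff.2 hv0) h3
      linarith
    refine hR v hv0 ?_
    have h5 : (1 / 2 : ℝ) • (R v + v) = 0 := by
      rw [h4] at h1
      rw [smul_add, add_comm]
      convert h1 using 2
      norm_num
    rw [eq_neg_iff_add_eq_zero]
    exact (smul_eq_zero.1 h5).resolve_left (by norm_num)
  have h0 : f 0 = 1 := by simp [hf]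
  have h1 : f 1 = LinearMap.det (R.toLinearEquiv : E →ₗ[ℝ] E) := by simp [hf]
  have hpos : 0 < f 1 := by
    by_contra! hle
    obtain ⟨t, ht, hft⟩ := intermediate_value_Icc' (zero_le_one) hcont.continuousOn
      (show (0 : ℝ) ∈ Set.Icc (f 1) (f 0) from ⟨hle, by rw [h0]; exact zero_le_one⟩)
    exact hne t ht hft
  rw [h1] at hpos
  have hnorm := R.toLinearIsometry.normDet_eq_one
  rw [LinearMap.normDet_eq_norm_det] at hnorm
  rw [← hnorm]
  exact (Real.norm_of_nonneg hpos.le).symm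

/-- Two subspaces whose orthogonal projections `P`, `P'` are at distance at most `ε < 1` are
interchanged by the reflection `J = sign (P + P' - 1)`: if `e` is an eigenvector of `P + P' - 1`
with eigenvalue `μ`, then `P e + P' e` and `P e - P' e` lie in the eigenspaces of `μ` and `-μ`, so
that `J P e = P' J e`. The rotation is the product of `J` and the reflection
`2 P - 1` in the first subspace. -/
theorem Submodule.exists_rotation_of_norm_starProjection_sub_le (W W' : Submodule ℝ E) {ε : ℝ}
    (hε : ε < 1) (h : ‖W.starProjection - W'.starProjection‖ ≤ ε) :
    ∃ R : E ≃ₗᵢ[ℝ] E, LinearMap.det (R.toLinearEquiv : E →ₗ[ℝ] E) = 1 ∧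
      (∀ v, R (W.starProjection v) = W'.starProjection (R v)) ∧
      ∀ v, ‖R v - v‖ ≤ 2 * ε * ‖v‖ := by
  have hε0 : 0 ≤ ε := (norm_nonneg _).trans h
  set P := W.starProjection with hP
  set P' := W'.starProjection with hP'
  have hPP : ∀ v, P (P v) = P v := fun v =>
    Submodule.starProjection_eq_self_iff.2 (W.starProjection_apply_mem v)
  have hPP' : ∀ v, P' (P' v) = P' v := fun v =>
    Submodule.starProjection_eq_self_iff.2 (W'.starProjection_apply_mem v)
  set D : E →ₗ[ℝ] E := (P : E →ₗ[ℝ] E) + (P' : E →ₗ[ℝ] E) - LinearMap.id with hD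
  have hDv : ∀ v, D v = P v + P' v - v := fun v => rfl
  have hDs : D.IsSymmetric :=
    ((W.starProjection_isSymmetric).add (W'.starProjection_isSymmetric)).sub LinearMap.IsSymmetric.id
  have hDP : ∀ v, D (P v) = P' (D v) := by
    intro v; simp only [hDv, map_add, map_sub, hPP, hPP']; abel
  have hDP' : ∀ v, D (P' v) = P (D v) := by
    intro v; simp only [hDv, map_add, map_sub, hPP, hPP']; abel
  -- `D² = 1 - (P - P')²`
  have hD2 : ∀ v, v - D (D v) = (P - P') ((P - P') v) := by
    intro v
    simp only [hDv, map_add, map_sub, hPP, hPP', sub_apply]; abel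
  have hdiff : ∀ v, ‖(P - P') v‖ ≤ ε * ‖v‖ := fun v => (P - P').le_of_opNorm_le h v
  let b := hDs.eigenvectorBasis (rfl : Module.finrank ℝ E = _)
  let lam := hDs.eigenvalues (rfl : Module.finrank ℝ E = _)
  have hb : ∀ k, D (b k) = lam k • b k := fun k => hDs.apply_eigenvectorBasis rfl k
  have hlam : ∀ k, (lam k) ^ 2 ≤ 1 ∧ 1 - ε ^ 2 ≤ (lam k) ^ 2 := by
    intro k
    have hbk : ‖b k‖ = 1 := b.norm_eq_one k
    have h1 : (1 - lam k ^ 2) • b k = (P - P') ((P - P') (b k)) := by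
      rw [← hD2, hb, map_smul, hb, smul_smul, sub_smul, one_smul, sq]
    have hsymm : inner ℝ ((P - P') ((P - P') (b k))) (b k) = ‖(P - P') (b k)‖ ^ 2 := by
      rw [← real_inner_self_eq_norm_sq]
      exact ((W.starProjection_isSymmetric).sub (W'.starProjection_isSymmetric)) _ _
    rw [← h1, real_inner_smul_left, real_inner_self_eq_norm_sq, hbk] at hsymm
    have h2 := hdiff (b k)
    rw [hbk, mul_one] at h2
    have h3 : ‖(P - P') (b k)‖ ^ 2 ≤ ε ^ 2 := by gcongr
    constructor <;> nlinarith [sq_nonneg ‖(P - P') (b k)‖]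
  have hlam0 : ∀ k, lam k ≠ 0 := by
    intro k h0
    have := (hlam k).2
    rw [h0] at this
    nlinarith
  let N : Submodule ℝ E := ⨆ μ : Set.Ioi (0 : ℝ), Module.End.eigenspace D μ
  let J : E ≃ₗᵢ[ℝ] E := N.reflection
  have hJpos : ∀ (μ : ℝ) (v : E), 0 < μ → D v = μ • v → J v = v := by
    intro μ v hμ hv
    refine Submodule.reflection_mem_subspace_eq_self ?_
    exact Submodule.mem_iSup_of_mem (⟨μ, hμ⟩ : Set.Ioi (0 : ℝ)) (Module.End.mem_eigenspace_iff.2 hv)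
  have hJneg : ∀ (μ : ℝ) (v : E), μ < 0 → D v = μ • v → J v = -v := by
    intro μ v hμ hv
    refine Submodule.reflection_mem_subspace_orthogonalComplement_eq_neg ?_
    rw [← Submodule.iInf_orthogonal, Submodule.mem_iInf]
    rintro ⟨ν, hν⟩
    rw [Submodule.mem_orthogonal]
    intro u hu
    rw [Module.End.mem_eigenspace_iff] at hu
    have h1 := hDs u v
    rw [hu, hv, real_inner_smul_left, real_inner_smul_right] at h1
    have hν' : (0 : ℝ) < ν := hν
    have h2 : (ν - μ) * inner ℝ u v = 0 := by
      have h1' : ν * inner ℝ u v = μ * inner ℝ u v := h1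
      linear_combination h1'
    exact (mul_eq_zero.1 h2).resolve_left (by linarith)
  have hJP : ∀ v, J (P v) = P' (J v) := by
    intro v
    suffices hlin : (J.toLinearEquiv : E →ₗ[ℝ] E) ∘ₗ (P : E →ₗ[ℝ] E) =
        (P' : E →ₗ[ℝ] E) ∘ₗ (J.toLinearEquiv : E →ₗ[ℝ] E) from LinearMap.congr_fun hlin v
    refine b.toBasis.ext fun k => ?_
    simp only [OrthonormalBasis.coe_toBasis]
    change J (P (b k)) = P' (J (b k))
    have hs : D (P (b k) + P' (b k)) = lam k • (P (b k) + P' (b k)) := by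
      rw [map_add, hDP, hDP', hb, map_smul, map_smul, smul_add, add_comm]
    have hd : D (P (b k) - P' (b k)) = (-lam k) • (P (b k) - P' (b k)) := by
      rw [map_sub, hDP, hDP', hb, map_smul, map_smul, neg_smul, smul_sub]; abel
    have h2 : (2 : ℝ) • J (P (b k)) =
        J (P (b k) + P' (b k)) + J (P (b k) - P' (b k)) := by
      rw [← map_add, ← map_smul]; congr 1; rw [two_smul]; abel
    have h3 : (2 : ℝ) • J (P (b k)) = (2 : ℝ) • P' (J (b k)) := by
      rw [h2]
      rcases lt_or_gt_of_ne (hlam0 k) with hneg | hpos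
      · rw [hJneg _ _ hneg hs, hJpos _ _ (neg_pos.2 hneg) hd, hJneg _ _ hneg (hb k), map_neg,
          two_smul]
        abel
      · rw [hJpos _ _ hpos hs, hJneg _ _ (neg_neg_of_pos hpos) hd, hJpos _ _ hpos (hb k),
          two_smul]
        abel
    exact smul_right_injective E (two_ne_zero' ℝ) h3
  have hJsymm : ∀ u v, inner ℝ (J u) v = inner ℝ u (J v) := by
    intro u v
    rw [← J.inner_map_map, show J (J u) = u from N.reflection_reflection u]
  have hJD : ∀ v, ‖J v - D v‖ ≤ ε ^ 2 * ‖v‖ := by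
    intro v
    refine le_of_sq_le_sq ?_ (by positivity)
    rw [mul_pow, ← b.sum_sq_norm_inner_right, ← b.sum_sq_norm_inner_right v, Finset.mul_sum]
    refine Finset.sum_le_sum fun k _ => ?_
    obtain ⟨h1, h2⟩ := hlam k
    have key : ∃ s : ℝ, |s - lam k| ≤ ε ^ 2 ∧ J (b k) = s • b k := by
      rcases lt_or_gt_of_ne (hlam0 k) with hneg | hpos
      · exact ⟨-1, abs_le.2 ⟨by nlinarith, by nlinarith⟩, by
          rw [hJneg _ _ hneg (hb k)]; simp⟩
      · exact ⟨1, abs_le.2 ⟨by nlinarith, by nlinarith⟩, by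
          rw [hJpos _ _ hpos (hb k)]; simp⟩
    obtain ⟨s, hs, hJs⟩ := key
    have h3 : inner ℝ (b k) (J v - D v) = (s - lam k) * inner ℝ (b k) v := by
      rw [inner_sub_right, ← hJsymm, ← hDs, hJs, hb, real_inner_smul_left, real_inner_smul_left]
      ring
    rw [h3, norm_mul, mul_pow, Real.norm_eq_abs]
    gcongr
  let R : E ≃ₗᵢ[ℝ] E := W.reflection.trans J
  have hRv : ∀ v, R v = J (W.reflection v) := fun v => rfl
  have hJ2 : ∀ v, J (J v) = v := N.reflection_reflection
  have hbound : ∀ v, ‖R v - v‖ ≤ (ε + ε ^ 2) * ‖v‖ := by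
    intro v
    have h1 : ‖R v - v‖ = ‖W.reflection v - J v‖ := by
      rw [hRv, ← J.norm_map (W.reflection v - J v), map_sub, hJ2]
    have h2 : W.reflection v - J v = (P - P') v - (J v - D v) := by
      rw [Submodule.reflection_apply, hDv, two_smul]
      simp only [sub_apply, ← hP]
      abel
    rw [h1, h2]
    refine (norm_sub_le _ _).trans ?_
    rw [add_mul]
    exact add_le_add (hdiff v) (hJD v)
  refine ⟨R, R.det_eq_one_of_forall_ne_neg ?_, ?_, ?_⟩
  · intro v hv hRneg
    have h1 := hbound v
    rw [hRneg, ← neg_add', norm_neg, ← two_smul ℝ v, norm_smul, Real.norm_two] at h1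
    have h2 : 0 < ‖v‖ := norm_pos_iff.2 hv
    have h3 : (2 : ℝ) ≤ ε + ε ^ 2 := le_of_mul_le_mul_right h1 h2
    nlinarith
  · intro v
    have h1 : W.reflection (P v) = P v :=
      Submodule.reflection_mem_subspace_eq_self (W.starProjection_apply_mem v)
    have h2 : P (W.reflection v) = P v := by
      rw [Submodule.reflection_apply, two_smul, map_sub, map_add]
      simp only [← hP, hPP]
      abel
    rw [hRv, hRv, h1, ← hJP, h2]
  · intro v
    refine (hbound v).trans ?_
    gcongr
    nlinarith

end Rotation

/-! ### The tangent space of an imbedded manifold -/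

/-- A `C²` map that vanishes at the origin together with its derivative is `O(‖u‖²)` there. -/
theorem ContDiffAt.exists_norm_le_mul_sq {F G : Type*} [NormedAddCommGroup F] [NormedSpace ℝ F]
    [NormedAddCommGroup G] [NormedSpace ℝ G] {f : F → G} (hf : ContDiffAt ℝ 2 f 0)
    (h0 : f 0 = 0) (h1 : fderiv ℝ f 0 = 0) :
    ∃ C > 0, ∃ δ > 0, ∀ u, ‖u‖ < δ → ‖f u‖ ≤ C * ‖u‖ ^ 2 := by
  have hd : ∀ᶠ u in 𝓝 (0 : F), DifferentiableAt ℝ f u :=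
    (hf.eventually (by simp)).mono fun u hu => hu.differentiableAt (by norm_num)
  have hO := (ContDiffAt.differentiableAt (n := 1) (hf.fderiv_right (by norm_num))
    (by norm_num)).isBigO_sub
  simp only [h1, sub_zero] at hO
  obtain ⟨C, hC, hO⟩ := hO.exists_pos
  obtain ⟨δ, hδ, hball⟩ := Metric.eventually_nhds_iff_ball.1 (hd.and hO.bound)
  refine ⟨C, hC, δ, hδ, fun u hu => ?_⟩
  have h := (convex_closedBall (0 : F) ‖u‖).norm_image_sub_le_of_norm_fderiv_le
    (f := f) (C := C * ‖u‖) (𝕜 := ℝ) (x := 0) (y := u)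
    (fun v hv => (hball v (by
      rw [mem_ball_zero_iff]; exact (mem_closedBall_zero_iff.1 hv).trans_lt hu)).1)
    (fun v hv => ((hball v (by
      rw [mem_ball_zero_iff]; exact (mem_closedBall_zero_iff.1 hv).trans_lt hu)).2).trans (by
        gcongr; exact mem_closedBall_zero_iff.1 hv))
    (by simp) (by simp)
  simpa [h0, sq, mul_assoc] using h

section Manifold

variable {n d : ℕ} {M : Set (Euc n)}

/-- The tangent space, defined by secants, is the plane over which a patch is a graph. Hence the
manifold lies within `O(‖q - z‖²)` of it near `z`, and each of its vectors is the velocity at `z`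
of a curve in the manifold. -/
theorem IsCompactImbeddedManifold.tangentSpaceOf_approx (hM : IsCompactImbeddedManifold d M)
    {z : Euc n} (hz : z ∈ M) :
    (∃ C > 0, ∃ ρ > 0, ∀ q ∈ M, ‖q - z‖ < ρ →
      ‖(q - z) - (tangentSpaceOf M z).starProjection (q - z)‖ ≤ C * ‖q - z‖ ^ 2) ∧
    ∀ u ∈ tangentSpaceOf M z, ∃ γ : ℝ → Euc n,
      γ 0 = z ∧ HasDerivAt γ u 0 ∧ ∀ᶠ t in 𝓝 (0 : ℝ), γ t ∈ M := by
  obtain ⟨-, r₁, r₂, hr₂, hr, hpatch⟩ := hM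
  obtain ⟨T, -, Ψ, hΨ, hΨ0, hΨ1, hMT⟩ := hpatch z hz
  have hr₁ : 0 < r₁ := hr₂.trans hr
  have hΨat : ContDiffAt ℝ 2 Ψ 0 := hΨ.contDiffAt (Metric.ball_mem_nhds 0 hr₁)
  obtain ⟨C, hC, δ, hδ, hquad⟩ := hΨat.exists_norm_le_mul_sq hΨ0 hΨ1
  have happrox : ∀ q ∈ M, ‖q - z‖ < min r₂ δ →
      ‖(q - z) - T.starProjection (q - z)‖ ≤ C * ‖q - z‖ ^ 2 := by
    intro q hq hqz
    have hq' : q ∈ M ∩ Metric.ball z r₂ :=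
      ⟨hq, by rw [mem_ball_iff_norm]; exact hqz.trans_le (min_le_left _ _)⟩
    rw [hMT] at hq'
    obtain ⟨⟨x, -, hx⟩, -⟩ := hq'
    have hP : T.starProjection (q - z) = x :=
      Submodule.eq_starProjection_of_mem_orthogonal' x.2 (Ψ x).2 (by rw [hx]; abel)
    have hxn : ‖x‖ ≤ ‖q - z‖ := by
      have := T.norm_starProjection_apply_le (q - z)
      rwa [hP] at this
    have hd : (q - z) - T.starProjection (q - z) = (Ψ x : Euc n) := by
      rw [hP, hx]; abel
    rw [hd]
    refine (hquad x (hxn.trans_lt (hqz.trans_le (min_le_right _ _)))).trans ?_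
    gcongr
  set G : T → Euc n := fun x => z + (x : Euc n) + (Ψ x : Euc n) with hG
  have hG0 : G 0 = z := by simp [hG, hΨ0]
  have hGd : HasFDerivAt G T.subtypeL 0 := by
    have h1 : HasFDerivAt Ψ (0 : T →L[ℝ] Tᗮ) 0 := by
      rw [← hΨ1]; exact (hΨat.differentiableAt (by norm_num)).hasFDerivAt
    have h2 := (T.subtypeL.hasFDerivAt (x := (0 : T))).const_add z |>.add
      ((Tᗮ).subtypeL.hasFDerivAt.comp (0 : T) h1)
    have h3 : T.subtypeL + (Tᗮ).subtypeL ∘L (0 : T →L[ℝ] Tᗮ) = T.subtypeL := by simp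
    rw [h3] at h2
    exact h2
  have hGM : ∀ᶠ x in 𝓝 (0 : T), G x ∈ M := by
    have h1 : ∀ᶠ x in 𝓝 (0 : T), G x ∈ Metric.ball z r₂ :=
      hGd.continuousAt (by rw [hG0]; exact Metric.ball_mem_nhds z hr₂)
    filter_upwards [h1, Metric.ball_mem_nhds (0 : T) hr₁] with x hx hx'
    have : G x ∈ M ∩ Metric.ball z r₂ := by
      rw [hMT]; exact ⟨⟨x, by simpa using hx', rfl⟩, hx⟩
    exact this.1
  have hST : tangentSpaceOf M z = T := by
    refine le_antisymm (Submodule.span_le.2 fun y hy => ?_) fun y hy => ?_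
    · -- the component normal to `T` has, along `M`, both itself and zero as derivative at `z`
      have h1 : HasFDerivWithinAt (fun q => (ContinuousLinearMap.id ℝ (Euc n) - T.starProjection)
          (q - z)) (ContinuousLinearMap.id ℝ (Euc n) - T.starProjection) M z :=
        (((ContinuousLinearMap.id ℝ (Euc n) - T.starProjection).hasFDerivAt).comp z
          ((hasFDerivAt_id z).sub_const z)).hasFDerivWithinAt
      have h2 : HasFDerivWithinAt (fun q => (ContinuousLinearMap.id ℝ (Euc n) - T.starProjection)
          (q - z)) (0 : Euc n →L[ℝ] Euc n) M z := by
        refine HasFDerivWithinAt.of_isLittleO ?_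
        simp only [sub_self, map_zero, sub_zero, zero_apply]
        have h3 : (fun q => (ContinuousLinearMap.id ℝ (Euc n) - T.starProjection) (q - z))
            =O[𝓝[M] z] fun q => ‖q - z‖ ^ 2 := by
          refine Asymptotics.IsBigO.of_bound C ?_
          filter_upwards [self_mem_nhdsWithin, mem_nhdsWithin_of_mem_nhds
            (Metric.ball_mem_nhds z (lt_min hr₂ hδ))] with q hq hqb
          rw [Real.norm_of_nonneg (by positivity)]
          exact happrox q hq (mem_ball_iff_norm.1 hqb)
        refine h3.trans_isLittleO ?_
        have h4 : (fun q : Euc n => q - z) =o[𝓝[M] z] fun _ => (1 : ℝ) := by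
          rw [Asymptotics.isLittleO_one_iff]
          exact tendsto_sub_nhds_zero_iff.2 (Filter.tendsto_id.mono_left nhdsWithin_le_nhds)
        have h5 := h4.norm_left.mul_isBigO (Asymptotics.isBigO_refl (fun q => ‖q - z‖) (𝓝[M] z))
        simpa [sq] using h5
      have h6 := h1.unique_on h2 hy
      simp only [sub_apply, ContinuousLinearMap.id_apply, zero_apply, sub_eq_zero] at h6
      exact Submodule.starProjection_eq_self_iff.1 h6.symm
    · have h1 := (hGd.hasFDerivWithinAt (s := {x | G x ∈ M})).mapsTo_tangent_cone
      rw [tangentConeAt_of_mem_nhds hGM, hG0] at h1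
      refine Submodule.subset_span (tangentConeAt_mono (𝕜 := ℝ) ?_ (h1 (Set.mem_univ ⟨y, hy⟩)))
      rintro _ ⟨x, hx, rfl⟩
      exact hx
  rw [hST]
  refine ⟨⟨C, hC, min r₂ δ, lt_min hr₂ hδ, happrox⟩, fun u hu => ?_⟩
  have hline : HasDerivAt (fun t : ℝ => t • (⟨u, hu⟩ : T)) ⟨u, hu⟩ 0 := by
    simpa using (hasDerivAt_id (0 : ℝ)).smul_const (⟨u, hu⟩ : T)
  refine ⟨fun t => G (t • ⟨u, hu⟩), by simp [hG0], ?_, ?_⟩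
  · have hGd' : HasFDerivAt G T.subtypeL ((0 : ℝ) • (⟨u, hu⟩ : T)) := by simpa using hGd
    exact hGd'.comp_hasDerivAt (0 : ℝ) hline
  · have h1 := hline.continuousAt.tendsto
    rw [zero_smul] at h1
    exact h1.eventually hGM

/-- First-order condition: at a local minimum over the manifold the derivative vanishes on the
tangent space. -/
theorem IsCompactImbeddedManifold.fderiv_eq_zero_of_isLocalMinOn
    (hM : IsCompactImbeddedManifold d M) {z : Euc n} (hz : z ∈ M) {f : Euc n → ℝ}
    {f' : Euc n →L[ℝ] ℝ} (hf : HasFDerivAt f f' z) (hmin : ∀ᶠ q in 𝓝[M] z, f z ≤ f q)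
    {u : Euc n} (hu : u ∈ tangentSpaceOf M z) : f' u = 0 := by
  obtain ⟨γ, hγ0, hγ, hγM⟩ := (hM.tangentSpaceOf_approx hz).2 u hu
  rw [← hγ0] at hf
  have h1 := hf.comp_hasDerivAt (0 : ℝ) hγ
  refine IsLocalMin.hasDerivAt_eq_zero ?_ h1
  have h2 : Filter.Tendsto γ (𝓝 0) (𝓝[M] z) := by
    refine tendsto_nhdsWithin_iff.2 ⟨?_, hγM⟩
    have := hγ.continuousAt.tendsto
    rwa [hγ0] at this
  filter_upwards [h2.eventually hmin] with t ht
  simpa [hγ0] using ht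

/-- Near `z ∈ M` and for `ν` normal at `z`, the point `z` is a nearest point of `M` to `z + s ν`
when `s > 0` is small. -/
theorem IsCompactImbeddedManifold.exists_nearest_of_normal
    (hM : IsCompactImbeddedManifold d M) {z : Euc n} (hz : z ∈ M) {ν : Euc n} (hν1 : ‖ν‖ = 1)
    (hν : ν ∈ (tangentSpaceOf M z)ᗮ) : ∃ s₀ > 0, ∀ q ∈ M, s₀ ≤ ‖z + s₀ • ν - q‖ := by
  obtain ⟨⟨C, hC, ρ, hρ, happ⟩, -⟩ := hM.tangentSpaceOf_approx hz
  refine ⟨min (ρ / 2) (1 / (2 * C)), by positivity, fun q hq => ?_⟩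
  set s := min (ρ / 2) (1 / (2 * C)) with hs
  have hs0 : 0 < s := by positivity
  have hs1 : s ≤ ρ / 2 := min_le_left _ _
  have hs2 : 2 * s * C ≤ 1 := by
    have : s ≤ 1 / (2 * C) := min_le_right _ _
    rw [le_div_iff₀ (by positivity)] at this
    linarith
  have hexp : ‖z + s • ν - q‖ ^ 2 = ‖q - z‖ ^ 2 - 2 * s * inner ℝ (q - z) ν + s ^ 2 := by
    have : z + s • ν - q = s • ν - (q - z) := by abel
    rw [this, norm_sub_sq_real, norm_smul, hν1, real_inner_smul_left, real_inner_comm,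
      Real.norm_of_nonneg hs0.le]
    ring
  rcases lt_or_ge ‖q - z‖ ρ with hlt | hge
  · have h1 := happ q hq hlt
    have h2 : inner ℝ (q - z) ν ≤ C * ‖q - z‖ ^ 2 := by
      have h3 : inner ℝ (q - z) ν =
          inner ℝ ((q - z) - (tangentSpaceOf M z).starProjection (q - z)) ν := by
        have h4 := (Submodule.mem_orthogonal _ _).1 hν _
          (Submodule.starProjection_apply_mem _ (q - z))
        rw [inner_sub_left (q - z), h4, sub_zero]
      rw [h3]
      refine (real_inner_le_norm _ _).trans ?_
      rwa [hν1, mul_one]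
    refine le_of_sq_le_sq ?_ (norm_nonneg _)
    rw [hexp]
    nlinarith [sq_nonneg ‖q - z‖]
  · have h1 : ‖q - z‖ ≤ ‖z + s • ν - q‖ + s := by
      have : q - z = s • ν - (z + s • ν - q) := by abel
      rw [this]
      refine (norm_sub_le _ _).trans ?_
      rw [norm_smul, hν1, Real.norm_of_nonneg hs0.le, mul_one, add_comm]
    linarith

/-- The segment from a point to a nearest point of the manifold is normal to the manifold. -/
theorem IsCompactImbeddedManifold.sub_mem_orthogonal_of_nearest
    (hM : IsCompactImbeddedManifold d M) {p q : Euc n} (hq : q ∈ M)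
    (hmin : ∀ q' ∈ M, ‖p - q‖ ≤ ‖p - q'‖) : p - q ∈ (tangentSpaceOf M q)ᗮ := by
  rw [Submodule.mem_orthogonal]
  intro u hu
  have hf : HasFDerivAt (fun y : Euc n => ‖y - p‖ ^ 2) (2 • innerSL ℝ (q - p)) q := by
    simpa using! (hasStrictFDerivAt_norm_sq (q - p)).hasFDerivAt.comp q ((hasFDerivAt_id q).sub_const p)
  have h := hM.fderiv_eq_zero_of_isLocalMinOn hq hf (by
    filter_upwards [self_mem_nhdsWithin] with y hy
    rw [norm_sub_rev q, norm_sub_rev y]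
    have := hmin y hy
    gcongr) hu
  have h' : (2 : ℝ) * inner ℝ (q - p) u = 0 := by simpa [two_mul, two_smul, inner_sub_left] using h
  rw [← neg_sub q p, inner_neg_right, real_inner_comm]
  linarith

/-! ### Tangent balls and the reach -/

/-- Points of the open tube of radius `reach M` have only one nearest point in `M`. -/
theorem eq_of_nearest_of_lt_reach {τ : ℝ} (hτ : ENNReal.ofReal τ ≤ reach M) {p q q' : Euc n}
    (hp : Metric.infDist p M < τ) (hq : q ∈ M) (hq' : q' ∈ M)
    (h : dist p q = Metric.infDist p M) (h' : dist p q' = Metric.infDist p M) : q = q' := by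
  have hne : Metric.infEDist p M ≠ ⊤ := Metric.infEDist_ne_top ⟨q, hq⟩
  have h1 : Metric.infEDist p M < reach M := by
    refine lt_of_lt_of_le ?_ hτ
    exact (ENNReal.lt_ofReal_iff_toReal_lt hne).2 hp
  obtain ⟨ρ, hρ, hlt⟩ := lt_sSup_iff.1 h1
  have key : ∀ y, dist p y = Metric.infDist p M → edist p y = Metric.infEDist p M := by
    intro y hy
    rw [edist_dist, hy, Metric.infDist, ENNReal.ofReal_toReal hne]
  exact (hρ p hlt).unique ⟨hq, key q h⟩ ⟨hq', key q' h'⟩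

/-- If `y` has a single nearest point `ξ`, the distance to `M` increases from `y` in every
direction that makes an acute angle with `y - ξ`. -/
theorem exists_lt_infDist_add_smul (hMc : IsCompact M) {y ξ : Euc n} (hξ : ξ ∈ M)
    (huniq : ∀ q ∈ M, dist y q = Metric.infDist y M → q = ξ) {e : Euc n}
    (he : 0 < inner ℝ e (y - ξ)) :
    ∃ t₀ > (0 : ℝ), ∀ t : ℝ, 0 < t → t < t₀ → Metric.infDist y M < Metric.infDist (y + t • e) M := by
  set δ := Metric.infDist y M with hδ
  have hδ0 : 0 ≤ δ := Metric.infDist_nonneg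
  set Q : Set (Euc n) := M ∩ {q | inner ℝ e (y - q) ≤ inner ℝ e (y - ξ) / 2} with hQ
  have hQc : IsCompact Q := hMc.inter_right (isClosed_le (by fun_prop) continuous_const)
  have hgap : ∃ δ' > δ, ∀ q ∈ Q, δ' ≤ dist y q := by
    rcases Q.eq_empty_or_nonempty with hE | hne
    · exact ⟨δ + 1, by linarith, by simp [hE]⟩
    · obtain ⟨q₀, hq₀, hmin⟩ := hQc.exists_isMinOn hne
        (f := fun q => dist y q) (by fun_prop)
      refine ⟨dist y q₀, ?_, fun q hq => hmin hq⟩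
      refine lt_of_le_of_ne (Metric.infDist_le_dist_of_mem hq₀.1) fun heq => ?_
      have h1 : inner ℝ e (y - q₀) ≤ inner ℝ e (y - ξ) / 2 := hq₀.2
      rw [huniq q₀ hq₀.1 heq.symm] at h1
      linarith
  obtain ⟨δ', hδ', hQδ⟩ := hgap
  have hepos : 0 < ‖e‖ := by
    rw [norm_pos_iff]; rintro rfl; simp at he
  refine ⟨(δ' - δ) / ‖e‖, div_pos (by linarith) hepos, fun t ht ht' => ?_⟩
  obtain ⟨q, hq, hqd⟩ := hMc.exists_infDist_eq_dist ⟨ξ, hξ⟩ (y + t • e)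
  rw [hqd]
  by_cases hqQ : q ∈ Q
  · rw [lt_div_iff₀ hepos] at ht'
    have h1 := hQδ q hqQ
    have h2 : dist y q ≤ dist y (y + t • e) + dist (y + t • e) q := dist_triangle _ _ _
    have h3 : dist y (y + t • e) = t * ‖e‖ := by
      rw [dist_eq_norm, sub_add_cancel_left, norm_neg, norm_smul, Real.norm_of_nonneg ht.le]
    linarith
  · have h1 : inner ℝ e (y - ξ) / 2 < inner ℝ e (y - q) := by
      by_contra! hle; exact hqQ ⟨hq, hle⟩
    have h2 : δ ≤ dist y q := Metric.infDist_le_dist_of_mem hq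
    have h3 : dist (y + t • e) q ^ 2 =
        dist y q ^ 2 + 2 * t * inner ℝ e (y - q) + t ^ 2 * ‖e‖ ^ 2 := by
      rw [dist_eq_norm, dist_eq_norm, add_sub_right_comm, norm_add_sq_real, norm_smul,
        real_inner_smul_right, real_inner_comm, Real.norm_of_nonneg ht.le]
      ring
    refine lt_of_pow_lt_pow_left₀ 2 dist_nonneg ?_
    have h4 : 0 < t * inner ℝ e (y - q) := mul_pos ht (by linarith)
    have h5 : δ ^ 2 ≤ dist y q ^ 2 := by gcongr
    nlinarith [sq_nonneg (t * ‖e‖)]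

/-- A point `y` that maximizes the distance to `M` over a ball about `x₀` lies on the boundary of
the ball, in the direction from its nearest point `ξ`. Therefore, if `z` is nearest to
`x₀ = z + s ν`, the nearest point to `x₀` lies on the segment from `ξ` to `y`, so that `ξ = z`
and `z` is nearest also to `y = z + (s + h) ν`. -/
theorem nearest_extend (hMc : IsCompact M) {τ : ℝ} (hτ : ENNReal.ofReal τ ≤ reach M)
    {z ν : Euc n} (hz : z ∈ M) (hν : ‖ν‖ = 1) {s h : ℝ} (hh : 0 < h) (hhs : h ≤ s)
    (hsτ : s + h < τ) (hs : ∀ q ∈ M, s ≤ ‖z + s • ν - q‖) :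
    ∀ q ∈ M, s + h ≤ ‖z + (s + h) • ν - q‖ := by
  have hne : M.Nonempty := ⟨z, hz⟩
  have hs0 : 0 < s := hh.trans_le hhs
  set x₀ := z + s • ν with hx₀
  have hx₀z : dist x₀ z = s := by
    rw [dist_eq_norm, hx₀, add_sub_cancel_left, norm_smul, hν, Real.norm_of_nonneg hs0.le, mul_one]
  have hx₀M : Metric.infDist x₀ M = s := by
    refine le_antisymm (hx₀z ▸ Metric.infDist_le_dist_of_mem hz) ?_
    refine (Metric.le_infDist hne).2 fun q hq => ?_
    rw [dist_eq_norm]; exact hs q hq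
  obtain ⟨y, hy, hmax⟩ := (isCompact_closedBall x₀ h).exists_isMaxOn
    ⟨x₀, Metric.mem_closedBall_self hh.le⟩ (f := fun p => Metric.infDist p M)
    (Metric.continuous_infDist_pt M).continuousOn
  set δ := Metric.infDist y M with hδ
  have hmax' : ∀ p, dist p x₀ ≤ h → Metric.infDist p M ≤ δ := fun p hp => hmax hp
  have hsδ : s ≤ δ := hx₀M ▸ hmax' x₀ (by simpa using hh.le)
  have hδs : δ ≤ s + h := by
    have h1 := Metric.infDist_le_infDist_add_dist (s := M) (x := y) (y := x₀)
    rw [hx₀M] at h1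
    have h2 : dist y x₀ ≤ h := hy
    linarith
  have hδ0 : 0 < δ := hs0.trans_le hsδ
  obtain ⟨ξ, hξ, hyξ⟩ := hMc.exists_infDist_eq_dist hne y
  have hascent := fun e : Euc n => exists_lt_infDist_add_smul (e := e) hMc hξ
    (fun q hq hqd => eq_of_nearest_of_lt_reach hτ (hδs.trans_lt hsτ) hq hξ hqd hyξ.symm)
  set a := y - ξ with ha
  set b := y - x₀ with hb
  have han : ‖a‖ = δ := by rw [hδ, hyξ, dist_eq_norm]
  have hbn : ‖b‖ ≤ h := by rw [hb, ← dist_eq_norm]; exact hy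
  have hball : ∀ (e : Euc n) (t : ℝ), dist (y + t • e) x₀ = ‖b + t • e‖ := by
    intro e t; rw [dist_eq_norm, hb]; congr 1; abel
  have hbh : ‖b‖ = h := by
    by_contra hnh
    have hlt : ‖b‖ < h := lt_of_le_of_ne hbn hnh
    obtain ⟨t₀, ht₀, ht⟩ := hascent a (by rw [real_inner_self_eq_norm_sq, han]; positivity)
    set t := min (t₀ / 2) ((h - ‖b‖) / δ) with htd
    have ht0 : 0 < t := lt_min (by linarith) (div_pos (by linarith) hδ0)
    have h1 : t * δ ≤ h - ‖b‖ := by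
      rw [← le_div_iff₀ hδ0]; exact min_le_right _ _
    have h2 := ht t ht0 ((min_le_left _ _).trans_lt (by linarith))
    refine absurd (hmax' (y + t • a) ?_) (not_le.2 h2)
    rw [hball]
    refine (norm_add_le _ _).trans ?_
    rw [norm_smul, han, Real.norm_of_nonneg ht0.le]
    linarith
  -- `e` is the sum of the unit vectors along `a` and along `-b`
  set e := δ⁻¹ • a - h⁻¹ • b with he
  have hab : inner ℝ e a = δ - h⁻¹ * inner ℝ a b := by
    rw [he, inner_sub_left, real_inner_smul_left, real_inner_smul_left,
      real_inner_self_eq_norm_sq, han, real_inner_comm a b]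
    field_simp
  have heb : inner ℝ e b = δ⁻¹ * inner ℝ a b - h := by
    rw [he, inner_sub_left, real_inner_smul_left, real_inner_smul_left,
      real_inner_self_eq_norm_sq, hbh]
    field_simp
  have hee : ‖e‖ ^ 2 = δ⁻¹ * inner ℝ e a - h⁻¹ * inner ℝ e b := by
    rw [← real_inner_self_eq_norm_sq]
    nth_rewrite 2 [he]
    rw [inner_sub_right, real_inner_smul_right, real_inner_smul_right]
  have hrel : h * inner ℝ e a = -(δ * inner ℝ e b) := by
    rw [hab, heb]; field_simp; ring
  have he0 : e = 0 := by
    by_contra hne0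
    have hpos : 0 < ‖e‖ := norm_pos_iff.2 hne0
    have hea : inner ℝ e a = δ * ‖e‖ ^ 2 / 2 := by
      rw [hee]
      field_simp
      linear_combination hrel
    have heb' : inner ℝ e b = -(h * ‖e‖ ^ 2 / 2) := by
      rw [hea] at hrel
      have : δ * (inner ℝ e b + h * ‖e‖ ^ 2 / 2) = 0 := by linear_combination hrel
      have := (mul_eq_zero.1 this).resolve_left hδ0.ne'
      linarith
    obtain ⟨t₀, ht₀, ht⟩ := hascent e (by rw [hea]; positivity)
    set t := min (t₀ / 2) h with htd
    have ht0 : 0 < t := lt_min (by linarith) hh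
    have hth : t ≤ h := min_le_right _ _
    have h2 := ht t ht0 ((min_le_left _ _).trans_lt (by linarith))
    refine absurd (hmax' (y + t • e) ?_) (not_le.2 h2)
    rw [hball]
    refine le_of_sq_le_sq ?_ hh.le
    rw [norm_add_sq_real, norm_smul, real_inner_smul_right, hbh, real_inner_comm, heb',
      Real.norm_of_nonneg ht0.le]
    nlinarith [mul_nonneg (mul_nonneg ht0.le (sub_nonneg.2 hth)) (sq_nonneg ‖e‖)]
  have hba : b = (h / δ) • a := by
    have h1 : δ⁻¹ • a = h⁻¹ • b := sub_eq_zero.1 he0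
    rw [div_eq_mul_inv, mul_smul, h1, smul_smul, mul_inv_cancel₀ hh.ne', one_smul]
  have hx₀ξ : x₀ - ξ = (1 - h / δ) • a := by
    rw [sub_smul, one_smul, ← hba, ha, hb]; abel
  have hdist : dist x₀ ξ = δ - h := by
    rw [dist_eq_norm, hx₀ξ, norm_smul, han, Real.norm_of_nonneg]
    · field_simp
    · rw [sub_nonneg, div_le_one hδ0]; linarith
  have hle : s ≤ dist x₀ ξ := by rw [dist_eq_norm]; exact hs ξ hξ
  have hδe : δ = s + h := by linarith
  have hξz : ξ = z := eq_of_nearest_of_lt_reach hτ (by rw [hx₀M]; linarith) hξ hz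
    (by rw [hx₀M, hdist, hδe]; ring) (by rw [hx₀M, hx₀z])
  have hyz : z + (s + h) • ν = y := by
    have h1 : x₀ - ξ = s • ν := by rw [hξz, hx₀]; abel
    have h2 : s • ν = (s / (s + h)) • a := by
      rw [← h1, hx₀ξ, hδe]; congr 1; field_simp; ring
    have h3 : (s + h) • ν = a := by
      have h4 : ν = (s + h)⁻¹ • a := by
        have h5 := congrArg (fun w => s⁻¹ • w) h2
        simp only [smul_smul] at h5
        rw [inv_mul_cancel₀ hs0.ne', one_smul] at h5
        rw [h5]; congr 1; field_simp
      rw [h4, smul_smul, mul_inv_cancel₀ (by linarith), one_smul]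
    rw [h3, ha, hξz]; abel
  intro q hq
  rw [hyz, ← dist_eq_norm, ← hδe]
  exact Metric.infDist_le_dist_of_mem hq

/-- If `z` is nearest to some point of the ray from `z` in the direction of the unit vector `ν`,
it is nearest to all points of the ray that are closer to `z` than the reach. -/
theorem nearest_of_lt_reach (hMc : IsCompact M) {τ : ℝ} (hτ : ENNReal.ofReal τ ≤ reach M)
    {z ν : Euc n} (hz : z ∈ M) (hν : ‖ν‖ = 1) {s : ℝ} (hs0 : 0 < s)
    (hs : ∀ q ∈ M, s ≤ ‖z + s • ν - q‖) {σ : ℝ} (hσ : σ < τ) :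
    ∀ q ∈ M, σ ≤ ‖z + σ • ν - q‖ := by
  rcases le_total σ s with hle | hle
  · intro q hq
    have h1 : z + s • ν - q = (z + σ • ν - q) + (s - σ) • ν := by rw [sub_smul]; abel
    have h2 := hs q hq
    rw [h1] at h2
    have h3 := norm_add_le (z + σ • ν - q) ((s - σ) • ν)
    rw [norm_smul, hν, Real.norm_of_nonneg (by linarith)] at h3
    linarith
  · set S : Set ℝ := {t | t ∈ Set.Icc s σ ∧ ∀ q ∈ M, t ≤ ‖z + t • ν - q‖} with hS
    have hScl : IsClosed {t : ℝ | ∀ q ∈ M, t ≤ ‖z + t • ν - q‖} := by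
      simp only [Set.ofPred_forall]
      exact isClosed_iInter fun q => isClosed_iInter fun _ =>
        isClosed_le continuous_id (by fun_prop)
    have hSc : IsCompact S := isCompact_Icc.inter_right hScl
    obtain ⟨t, ⟨ht, htq⟩, htmax⟩ := hSc.exists_isGreatest ⟨s, ⟨le_rfl, hle⟩, hs⟩
    rcases ht.2.eq_or_lt with heq | hlt
    · rw [← heq]; exact htq
    · exfalso
      have ht0 : 0 < t := hs0.trans_le ht.1
      set h := min t (σ - t) with hh
      have hh0 : 0 < h := lt_min ht0 (by linarith)
      have h1 : h ≤ σ - t := min_le_right _ _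
      have h2 := nearest_extend hMc hτ hz hν hh0 (min_le_left _ _) (by linarith) htq
      have h3 : t + h ≤ t := htmax ⟨⟨by linarith [ht.1], by linarith⟩, h2⟩
      linarith

namespace IsCompactImbeddedManifold

variable (hM : IsCompactImbeddedManifold d M) {τ : ℝ} (hτ0 : 0 < τ)
  (hτ : ENNReal.ofReal τ ≤ reach M)

include hM hτ0 hτ

/-- The open balls of radius `τ / 2` that touch `M` at `z` on the side of a normal vector contain
no point of `M`. -/
theorem inner_normal_le {z q ν : Euc n} (hz : z ∈ M) (hq : q ∈ M)
    (hν : ν ∈ (tangentSpaceOf M z)ᗮ) : τ * inner ℝ (q - z) ν ≤ ‖q - z‖ ^ 2 * ‖ν‖ := by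
  rcases eq_or_ne ν 0 with rfl | hν0
  · simp
  have hνn : 0 < ‖ν‖ := norm_pos_iff.2 hν0
  set u := ‖ν‖⁻¹ • ν with hu
  have hu1 : ‖u‖ = 1 := by rw [hu, norm_smul, norm_inv, norm_norm, inv_mul_cancel₀ hνn.ne']
  obtain ⟨s, hs0, hs⟩ := hM.exists_nearest_of_normal hz hu1 (Submodule.smul_mem _ _ hν)
  have h1 := nearest_of_lt_reach hM.1 hτ hz hu1 hs0 hs (half_lt_self hτ0) q hq
  have h2 : (τ / 2) ^ 2 ≤ ‖z + (τ / 2) • u - q‖ ^ 2 := by gcongr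
  have h3 : z + (τ / 2) • u - q = (τ / 2) • u - (q - z) := by abel
  rw [h3, norm_sub_sq_real, norm_smul, hu1, real_inner_smul_left, Real.norm_of_nonneg (by positivity),
    hu, real_inner_smul_left, real_inner_comm] at h2
  have h4 : τ * (‖ν‖⁻¹ * inner ℝ (q - z) ν) ≤ ‖q - z‖ ^ 2 := by linarith
  calc τ * inner ℝ (q - z) ν = τ * (‖ν‖⁻¹ * inner ℝ (q - z) ν) * ‖ν‖ := by field_simp
    _ ≤ _ := by gcongr

theorem norm_sub_starProjection_le {z q : Euc n} (hz : z ∈ M) (hq : q ∈ M) :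
    ‖(q - z) - (tangentSpaceOf M z).starProjection (q - z)‖ ≤ ‖q - z‖ ^ 2 / τ := by
  set P := (tangentSpaceOf M z).starProjection with hP
  set ν := (q - z) - P (q - z) with hν
  have hmem : ν ∈ (tangentSpaceOf M z)ᗮ := Submodule.sub_starProjection_mem_orthogonal _
  have h1 := hM.inner_normal_le hτ0 hτ hz hq hmem
  have h2 : inner ℝ (q - z) ν = ‖ν‖ ^ 2 := by
    have h3 : q - z = ν + P (q - z) := by rw [hν]; abel
    rw [h3, inner_add_left, real_inner_self_eq_norm_sq,
      (Submodule.mem_orthogonal _ _).1 hmem _ (Submodule.starProjection_apply_mem _ _), add_zero]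
  rw [h2] at h1
  rw [le_div_iff₀ hτ0]
  rcases (norm_nonneg ν).eq_or_lt with h0 | hpos
  · rw [← h0]; simp only [zero_mul]; positivity
  · refine le_of_mul_le_mul_right ?_ hpos
    linarith

/-- Tangent vectors lead to points close to the manifold. The distance `δ` from `x + t u` to `M`
satisfies `t δ' ≤ δ + 4 t² ‖u‖² / τ`, because `x` lies outside the ball that touches `M` at the
nearest point of `x + t u` on the far side, and `δ = o(t)`. The function
`5 t² ‖u‖² / τ + η t` is a strict barrier for this differential inequality, for each `η > 0`. -/
theorem infDist_add_tangent_le {x u : Euc n} (hx : x ∈ M) (hu : u ∈ tangentSpaceOf M x) :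
    Metric.infDist (x + u) M ≤ 5 * ‖u‖ ^ 2 / τ := by
  have hne : M.Nonempty := ⟨x, hx⟩
  rcases eq_or_ne u 0 with rfl | hu0
  · simp [Metric.infDist_zero_of_mem hx]
  have hun : 0 < ‖u‖ := norm_pos_iff.2 hu0
  set C := 5 * ‖u‖ ^ 2 / τ with hC
  have hC0 : 0 < C := by positivity
  have hC4 : 4 * ‖u‖ ^ 2 < C * τ := by
    rw [hC, div_mul_cancel₀ _ hτ0.ne']; nlinarith [sq_pos_of_pos hun]
  refine le_of_forall_pos_le_add fun η hη => ?_
  set f : ℝ → ℝ := fun t => Metric.infDist (x + t • u) M with hf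
  choose q hqM hq using fun t : ℝ => hM.1.exists_infDist_eq_dist hne (x + t • u)
  have hq' : ∀ t, f t = ‖x + t • u - q t‖ := fun t => by rw [← dist_eq_norm]; exact hq t
  have hfle : ∀ t t', f t' ≤ ‖x + t' • u - q t‖ := fun t t' => by
    rw [← dist_eq_norm]; exact Metric.infDist_le_dist_of_mem (hqM t)
  have hf0 : ∀ t, 0 ≤ f t := fun t => Metric.infDist_nonneg
  -- the barrier is compared with `f` on `[a, 1]`; the term `η t` provides a starting point `a > 0`
  obtain ⟨a, ha0, ha1, hfa⟩ : ∃ a : ℝ, 0 < a ∧ a < 1 ∧ f a ≤ η * a := by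
    obtain ⟨γ, hγ0, hγ, hγM⟩ := (hM.tangentSpaceOf_approx hx).2 u hu
    have h1 := (hasDerivAt_iff_isLittleO_nhds_zero.1 hγ).bound hη
    simp only [zero_add, hγ0] at h1
    have h2 : ∀ᶠ t : ℝ in 𝓝[>] 0, 0 < t ∧ t < 1 :=
      (eventually_mem_nhdsWithin).and (mem_nhdsWithin_of_mem_nhds (Iio_mem_nhds one_pos))
    obtain ⟨a, ⟨ha0, ha1⟩, hab, haM⟩ :=
      (h2.and (mem_nhdsWithin_of_mem_nhds (h1.and hγM))).exists
    refine ⟨a, ha0, ha1, (Metric.infDist_le_dist_of_mem haM).trans ?_⟩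
    rw [Real.norm_of_nonneg ha0.le] at hab
    rw [dist_comm, dist_eq_norm, ← sub_sub]
    exact hab
  -- squares are compared, since `f` need not have a derivative bound where it vanishes
  have hcmp := image_le_of_liminf_slope_right_lt_deriv_boundary' (a := a) (b := 1)
    (f := fun t => f t ^ 2) (f' := fun t => 2 * inner ℝ (x + t • u - q t) u)
    (B := fun t => (C * t ^ 2 + η * t) ^ 2)
    (B' := fun t => 2 * (C * t ^ 2 + η * t) * (2 * C * t + η))
    (by
      have : Continuous f := (Metric.continuous_infDist_pt M).comp (by fun_prop)
      exact (this.pow 2).continuousOn)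
    (by
      intro t ht r hr
      have hg : HasDerivAt (fun t' : ℝ => ‖x + t' • u - q t‖ ^ 2)
          (2 * inner ℝ (x + t • u - q t) u) t := by
        have h1 : HasDerivAt (fun t' : ℝ => x + t' • u - q t) u t := by
          simpa using (((hasDerivAt_id t).smul_const u).const_add x).sub_const (q t)
        exact h1.norm_sq
      have h2 := (hasDerivAt_iff_tendsto_slope.1 hg).mono_left
        (nhdsWithin_mono t (fun t' (ht' : t' ∈ Set.Ioi t) => (Set.mem_Ioi.1 ht').ne'))
      refine (((h2.eventually (gt_mem_nhds hr)).and self_mem_nhdsWithin).mono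
        fun t' ht' => lt_of_le_of_lt ?_ ht'.1).frequently
      have htt' : t < t' := ht'.2
      simp only [slope_def_field]
      have h3 := hfle t t'
      have h4 := hf0 t'
      rw [hq' t]
      have h5 : 0 < t' - t := sub_pos.2 htt'
      gcongr)
    (by
      have h1 : 0 ≤ C * a ^ 2 := by positivity
      have h2 := hf0 a
      have h3 : f a ≤ C * a ^ 2 + η * a := by linarith
      gcongr)
    (by fun_prop)
    (by
      intro t _
      have h1 : HasDerivAt (fun t : ℝ => C * t ^ 2 + η * t) (2 * C * t + η) t := by
        have := ((hasDerivAt_pow 2 t).const_mul C).add ((hasDerivAt_id t).const_mul η)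
        refine this.congr_deriv ?_
        simp; ring
      refine (h1.pow 2).hasDerivWithinAt.congr_deriv ?_
      simp)
    (by
      intro t ht heq
      have ht0 : 0 < t := ha0.trans_le ht.1
      have hB0 : 0 < C * t ^ 2 + η * t := by positivity
      have hft : f t = C * t ^ 2 + η * t :=
        (pow_left_inj₀ (hf0 t) hB0.le two_ne_zero).1 heq
      set w := x + t • u - q t with hw
      have hwn : ‖w‖ = C * t ^ 2 + η * t := by rw [← hft, hq' t]
      have hnormal : w ∈ (tangentSpaceOf M (q t))ᗮ :=
        hM.sub_mem_orthogonal_of_nearest (hqM t) fun q' hq'M => by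
          rw [← hq' t, ← dist_eq_norm]; exact Metric.infDist_le_dist_of_mem hq'M
      have h1 := hM.inner_normal_le hτ0 hτ (hqM t) hx (Submodule.neg_mem _ hnormal)
      have hxq : x - q t = w - t • u := by rw [hw]; abel
      have hwt : ‖w‖ ≤ t * ‖u‖ := by
        rw [← hq' t]
        refine (Metric.infDist_le_dist_of_mem hx).trans ?_
        rw [dist_eq_norm, add_sub_cancel_left, norm_smul, Real.norm_of_nonneg ht0.le]
      have hxqn : ‖x - q t‖ ≤ 2 * (t * ‖u‖) := by
        rw [hxq]
        refine (norm_sub_le _ _).trans ?_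
        rw [norm_smul, Real.norm_of_nonneg ht0.le]
        linarith
      have h2 : ‖x - q t‖ ^ 2 ≤ (2 * (t * ‖u‖)) ^ 2 := by gcongr
      rw [inner_neg_right, norm_neg] at h1
      nth_rewrite 1 [hxq] at h1
      rw [inner_sub_left, real_inner_self_eq_norm_sq, real_inner_smul_left, real_inner_comm] at h1
      rw [hwn] at h1
      -- after multiplication by `t τ` the claim follows from `4 ‖u‖² < C τ`
      set I := inner ℝ w u with hI
      set β := C * t ^ 2 + η * t with hβ
      have h3 : ‖x - q t‖ ^ 2 * β ≤ (2 * (t * ‖u‖)) ^ 2 * β := by gcongr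
      have h4 : t ^ 2 * (4 * ‖u‖ ^ 2) * β < t ^ 2 * (C * τ) * β := by gcongr
      have h5 : (t * τ) * (2 * I) < (t * τ) * (2 * β * (2 * C * t + η)) := by
        have h6 : (t * τ) * (2 * β * (2 * C * t + η)) = 2 * τ * β * (β + C * t ^ 2) := by
          rw [hβ]; ring
        rw [h6]
        nlinarith
      exact lt_of_mul_lt_mul_left h5 (by positivity))
    (Set.right_mem_Icc.2 ha1.le)
  have h1 : f 1 ^ 2 ≤ (C + η) ^ 2 := by simpa using hcmp
  have h2 : f 1 ≤ C + η := le_of_sq_le_sq h1 (by positivity)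
  simpa [hf] using h2

/-- Tangent spaces at nearby points are close: a short tangent vector at `x` leads to a point near
`M`, hence near the plane tangent to `M` at `y`. -/
theorem norm_sub_starProjection_tangent_le {x y u : Euc n} (hx : x ∈ M) (hy : y ∈ M)
    (hxy : ‖x - y‖ ≤ τ) (hu : u ∈ tangentSpaceOf M x) :
    ‖u - (tangentSpaceOf M y).starProjection u‖ ≤ 55 * (‖x - y‖ / τ) * ‖u‖ := by
  rcases eq_or_ne x y with rfl | hne
  · rw [Submodule.starProjection_eq_self_iff.2 hu]; simp
  rcases eq_or_ne u 0 with rfl | hu0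
  · simp
  set l := ‖x - y‖ with hl
  have hl0 : 0 < l := norm_pos_iff.2 (sub_ne_zero.2 hne)
  have hun : 0 < ‖u‖ := norm_pos_iff.2 hu0
  set N : Euc n →L[ℝ] Euc n := (tangentSpaceOf M y)ᗮ.starProjection with hN
  have hNv : ∀ v, N v = v - (tangentSpaceOf M y).starProjection v := fun v =>
    Submodule.starProjection_orthogonal_val v
  have hNle : ∀ v, ‖N v‖ ≤ ‖v‖ := fun v => Submodule.norm_starProjection_apply_le _ v
  set v := (l / ‖u‖) • u with hv
  have hvn : ‖v‖ = l := by
    rw [hv, norm_smul, Real.norm_of_nonneg (by positivity), div_mul_cancel₀ _ hun.ne']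
  obtain ⟨q, hq, hqd⟩ := hM.1.exists_infDist_eq_dist ⟨x, hx⟩ (x + v)
  have hqv : ‖x + v - q‖ ≤ 5 * l ^ 2 / τ := by
    rw [← dist_eq_norm, ← hqd, ← hvn]
    exact hM.infDist_add_tangent_le hτ0 hτ hx (Submodule.smul_mem _ _ hu)
  have hqv' : 5 * l ^ 2 / τ ≤ 5 * l := by
    rw [div_le_iff₀ hτ0]; nlinarith
  have hqy : ‖q - y‖ ≤ 7 * l := by
    have h1 : q - y = (x - y) + v - (x + v - q) := by abel
    rw [h1]
    refine (norm_sub_le _ _).trans ?_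
    have h2 := norm_add_le (x - y) v
    linarith
  have h1 : ‖N (q - y)‖ ≤ 49 * l ^ 2 / τ := by
    rw [hNv]
    refine (hM.norm_sub_starProjection_le hτ0 hτ hy hq).trans ?_
    gcongr
    nlinarith [norm_nonneg (q - y)]
  have h2 : ‖N (x - y)‖ ≤ l ^ 2 / τ := by
    rw [hNv]; exact hM.norm_sub_starProjection_le hτ0 hτ hy hx
  have h3 : ‖N v‖ ≤ 55 * (l / τ) * l := by
    have h4 : v = (q - y) - (x - y) + (x + v - q) := by abel
    rw [h4, map_add, map_sub]
    refine (norm_add_le _ _).trans ?_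
    have h5 := norm_sub_le (N (q - y)) (N (x - y))
    have h6 := hNle (x + v - q)
    have h7 : 55 * (l / τ) * l = 49 * l ^ 2 / τ + l ^ 2 / τ + 5 * l ^ 2 / τ := by ring
    linarith
  rw [← hNv]
  rw [hv, map_smul, norm_smul, Real.norm_of_nonneg (by positivity)] at h3
  have h8 : l * ‖N u‖ ≤ l * (55 * (l / τ) * ‖u‖) := by
    have h9 : l / ‖u‖ * ‖N u‖ * ‖u‖ ≤ 55 * (l / τ) * l * ‖u‖ := by gcongr
    have h10 : l / ‖u‖ * ‖N u‖ * ‖u‖ = l * ‖N u‖ := by field_simp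
    linarith
  exact le_of_mul_le_mul_left h8 hl0

end IsCompactImbeddedManifold

/-- Two subspaces each of which is within angle `ε` of the other have projections at distance at
most `2 ε`. -/
theorem Submodule.norm_starProjection_sub_le (S S' : Submodule ℝ (Euc n)) {ε : ℝ} (hε : 0 ≤ ε)
    (h : ∀ u ∈ S, ‖u - S'.starProjection u‖ ≤ ε * ‖u‖)
    (h' : ∀ u ∈ S', ‖u - S.starProjection u‖ ≤ ε * ‖u‖) :
    ‖S.starProjection - S'.starProjection‖ ≤ 2 * ε := by
  refine ContinuousLinearMap.opNorm_le_bound _ (by positivity) fun v => ?_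
  have h0 : (S.starProjection - S'.starProjection) v =
      (S.starProjection v - S'.starProjection (S.starProjection v)) -
        S'.starProjection (v - S.starProjection v) := by
    rw [sub_apply, map_sub]; abel
  have h1 : ‖S.starProjection v - S'.starProjection (S.starProjection v)‖ ≤ ε * ‖v‖ := by
    refine (h _ (S.starProjection_apply_mem v)).trans ?_
    gcongr
    exact S.norm_starProjection_apply_le v
  have h2 : ‖S'.starProjection (v - S.starProjection v)‖ ≤ ε * ‖v‖ := by
    set w := v - S.starProjection v with hw
    have hwv : ‖w‖ ≤ ‖v‖ := by
      rw [hw, ← Submodule.starProjection_orthogonal_val]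
      exact Submodule.norm_starProjection_apply_le _ v
    have hwS : w ∈ Sᗮ := Submodule.sub_starProjection_mem_orthogonal v
    set p := S'.starProjection w with hp
    have hpp : ‖p‖ ^ 2 = inner ℝ (p - S.starProjection p) w := by
      rw [inner_sub_left, (Submodule.mem_orthogonal _ _).1 hwS _ (S.starProjection_apply_mem p),
        sub_zero, ← real_inner_self_eq_norm_sq]
      have h3 := Submodule.inner_starProjection_left_eq_right S' p w
      rwa [Submodule.starProjection_eq_self_iff.2 (S'.starProjection_apply_mem w), eq_comm] at h3
    have h4 : ‖p‖ ^ 2 ≤ ε * ‖p‖ * ‖w‖ := by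
      rw [hpp]
      refine (real_inner_le_norm _ _).trans ?_
      gcongr
      exact h' p (S'.starProjection_apply_mem w)
    rcases (norm_nonneg p).eq_or_lt with h5 | h5
    · rw [← h5]; positivity
    · have h6 : ‖p‖ ≤ ε * ‖w‖ := by
        refine le_of_mul_le_mul_right ?_ h5
        linarith
      exact h6.trans (by gcongr)
  rw [h0]
  refine (norm_sub_le _ _).trans ?_
  linarith

/-- Tangent spaces vary Lipschitz continuously, with a constant proportional to the inverse of the
reach. -/
theorem IsCompactImbeddedManifold.norm_starProjection_tangent_sub_le
    (hM : IsCompactImbeddedManifold d M) {τ : ℝ} (hτ0 : 0 < τ)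
    (hτ : ENNReal.ofReal τ ≤ reach M) {x y : Euc n} (hx : x ∈ M) (hy : y ∈ M)
    (hxy : ‖x - y‖ ≤ τ) :
    ‖(tangentSpaceOf M x).starProjection - (tangentSpaceOf M y).starProjection‖
      ≤ 110 * (‖x - y‖ / τ) := by
  have h := Submodule.norm_starProjection_sub_le (tangentSpaceOf M x) (tangentSpaceOf M y)
    (ε := 55 * (‖x - y‖ / τ)) (by positivity)
    (fun u hu => hM.norm_sub_starProjection_tangent_le hτ0 hτ hx hy hxy hu)
    (fun u hu => by
      rw [norm_sub_rev x y] at hxy ⊢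
      exact hM.norm_sub_starProjection_tangent_le hτ0 hτ hy hx hxy hu)
  linarith

/-! ### Projections of the manifold onto nearly tangent planes -/

namespace IsCompactImbeddedManifold

variable (hM : IsCompactImbeddedManifold d M) {τ : ℝ} (hτ0 : 0 < τ)
  (hτ : ENNReal.ofReal τ ≤ reach M)

include hM hτ0 hτ

theorem norm_sub_starProjection_le_of_near_tangent {x q : Euc n} (hx : x ∈ M) (hq : q ∈ M)
    {W : Submodule ℝ (Euc n)} {κ : ℝ}
    (hW : ‖W.starProjection - (tangentSpaceOf M x).starProjection‖ ≤ κ) :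
    ‖(q - x) - W.starProjection (q - x)‖ ≤ ‖q - x‖ ^ 2 / τ + κ * ‖q - x‖ := by
  have h1 : (q - x) - W.starProjection (q - x) =
      ((q - x) - (tangentSpaceOf M x).starProjection (q - x)) -
        (W.starProjection - (tangentSpaceOf M x).starProjection) (q - x) := by
    rw [sub_apply]; abel
  rw [h1]
  exact (norm_sub_le _ _).trans (add_le_add (hM.norm_sub_starProjection_le hτ0 hτ hx hq)
    (ContinuousLinearMap.le_of_opNorm_le _ hW _))

/-- The projection of `M` onto a nearly tangent plane covers a disc about the image of `x`. A point
`p` of `M` whose projection is nearest to the given `v` exists by compactness and is not on the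
boundary of the ball; by the first-order condition, `P_W (p - x) - v` is a vector of `W` normal to
`M` at `p`, and there is no such vector except zero, since `W` is nearly tangent at `p` too. -/
theorem exists_starProjection_eq {x : Euc n} (hx : x ∈ M)
    {W : Submodule ℝ (Euc n)} {κ ρ : ℝ} (hρ : 0 < ρ)
    (hW : ‖W.starProjection - (tangentSpaceOf M x).starProjection‖ ≤ κ)
    (hκ : 330 * (ρ / τ) + 3 * κ < 1) {v : Euc n} (hvW : v ∈ W) (hv : ‖v‖ ≤ ρ) :
    ∃ p ∈ M, ‖p - x‖ ≤ 3 * ρ ∧ W.starProjection (p - x) = v := by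
  have hκ0 : 0 ≤ κ := (norm_nonneg _).trans hW
  have hρτ : 0 < ρ / τ := div_pos hρ hτ0
  set P := W.starProjection with hP
  have hcont : Continuous fun q : Euc n => ‖P (q - x) - v‖ ^ 2 := by fun_prop
  obtain ⟨p, ⟨hpM, hpb⟩, hmin⟩ :=
    (hM.1.inter_right (Metric.isClosed_closedBall (x := x) (ε := 3 * ρ))).exists_isMinOn
      ⟨x, hx, Metric.mem_closedBall_self (by positivity)⟩ hcont.continuousOn
  have hpx : ‖p - x‖ ≤ 3 * ρ := by rw [← dist_eq_norm]; exact hpb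
  have hmin' : ∀ q ∈ M, ‖q - x‖ ≤ 3 * ρ → ‖P (p - x) - v‖ ^ 2 ≤ ‖P (q - x) - v‖ ^ 2 :=
    fun q hq hqx => hmin ⟨hq, by rw [Metric.mem_closedBall, dist_eq_norm]; exact hqx⟩
  have hint : ‖p - x‖ < 3 * ρ := by
    refine lt_of_le_of_ne hpx fun heq => ?_
    have h1 : ‖P (p - x) - v‖ ≤ ρ := by
      have h2 := hmin' x hx (by simp only [sub_self, norm_zero]; positivity)
      rw [sub_self, map_zero, zero_sub, norm_neg] at h2
      exact (le_of_sq_le_sq h2 (norm_nonneg _)).trans hv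
    have h3 := hM.norm_sub_starProjection_le_of_near_tangent hτ0 hτ hx hpM hW
    rw [heq] at h3
    have h4 : ‖p - x‖ ≤ ‖(p - x) - P (p - x)‖ + ‖P (p - x) - v‖ + ‖v‖ := by
      have h5 : p - x = ((p - x) - P (p - x)) + (P (p - x) - v) + v := by abel
      nth_rewrite 1 [h5]
      exact norm_add₃_le
    have h6 : (3 * ρ) ^ 2 / τ + κ * (3 * ρ) = ρ * (9 * (ρ / τ) + 3 * κ) := by ring
    nlinarith
  set w := P (p - x) - v with hw
  have hwW : w ∈ W := W.sub_mem (W.starProjection_apply_mem _) hvW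
  have hnormal : w ∈ (tangentSpaceOf M p)ᗮ := by
    rw [Submodule.mem_orthogonal]
    intro u hu
    have hf : HasFDerivAt (fun q : Euc n => ‖P (q - x) - v‖ ^ 2)
        ((2 • innerSL ℝ w).comp P) p := by
      have h1 : HasFDerivAt (fun q : Euc n => P (q - x) - v) P p := by
        simpa using! (P.hasFDerivAt.comp p ((hasFDerivAt_id p).sub_const x)).sub_const v
      exact (hasStrictFDerivAt_norm_sq w).hasFDerivAt.comp p h1
    have h := hM.fderiv_eq_zero_of_isLocalMinOn hpM hf (by
      have hnear : ∀ᶠ q in 𝓝[M] p, ‖q - x‖ < 3 * ρ :=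
        mem_nhdsWithin_of_mem_nhds
          ((continuous_id.sub continuous_const).norm.continuousAt.eventually (gt_mem_nhds hint))
      filter_upwards [self_mem_nhdsWithin, hnear] with q hq hqx
      exact hmin' q hq hqx.le) hu
    have h' : (2 : ℝ) * inner ℝ w (P u) = 0 := by
      simpa only [two_mul, two_smul, ContinuousLinearMap.comp_apply, add_apply,
        innerSL_apply_apply] using h
    have h2 : inner ℝ w (P u) = inner ℝ w u := by
      have h3 := W.inner_starProjection_left_eq_right w u
      rw [Submodule.starProjection_eq_self_iff.2 hwW] at h3
      exact h3.symm
    rw [h2] at h'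
    rw [real_inner_comm]
    linarith
  have hw0 : w = 0 := by
    by_contra hne
    have hwn : 0 < ‖w‖ := norm_pos_iff.2 hne
    have h1 : (tangentSpaceOf M p).starProjection w = 0 :=
      (Submodule.starProjection_apply_eq_zero_iff _).2 hnormal
    have h2 : w = (P - (tangentSpaceOf M x).starProjection) w +
        ((tangentSpaceOf M x).starProjection - (tangentSpaceOf M p).starProjection) w := by
      rw [sub_apply, sub_apply, h1, Submodule.starProjection_eq_self_iff.2 hwW]; abel
    have h3 : ‖x - p‖ / τ ≤ 3 * (ρ / τ) := by
      rw [norm_sub_rev, ← mul_div_assoc]; gcongr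
    have h4 : ‖x - p‖ ≤ τ := by
      rw [← div_le_one hτ0]; linarith
    have h5 := ContinuousLinearMap.le_of_opNorm_le _ hW w
    have h6 := ContinuousLinearMap.le_of_opNorm_le _
      (hM.norm_starProjection_tangent_sub_le hτ0 hτ hx hpM h4) w
    have h7 : ‖w‖ ≤ (κ + 110 * (‖x - p‖ / τ)) * ‖w‖ := by
      nth_rewrite 1 [h2]
      refine (norm_add_le _ _).trans ?_
      rw [add_mul]
      exact add_le_add h5 h6
    nlinarith
  exact ⟨p, hpM, hpx, sub_eq_zero.1 hw0⟩

/-! ### Volume and the number of cylinders -/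

/-- The orthogonal projection onto a plane does not increase volume, and it maps the part of `M`
near `x` onto a set that contains a disc of radius `ρ`. -/
theorem le_euclideanHausdorffMeasure_inter_ball {x : Euc n} (hx : x ∈ M)
    {W : Submodule ℝ (Euc n)} (hWd : Module.finrank ℝ W = d) {κ ρ : ℝ} (hρ : 0 < ρ)
    (hW : ‖W.starProjection - (tangentSpaceOf M x).starProjection‖ ≤ κ)
    (hκ : 330 * (ρ / τ) + 3 * κ < 1) {ρ' : ℝ} (hρ' : ρ * (1 + 9 * (ρ / τ) + 3 * κ) < ρ') :
    ENNReal.ofReal (ρ ^ d) * volume (Metric.ball (0 : EuclideanSpace ℝ (Fin d)) 1) ≤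
      μHE[d] (M ∩ Metric.ball x ρ') := by
  have hκ0 : 0 ≤ κ := (norm_nonneg _).trans hW
  let b : OrthonormalBasis (Fin d) ℝ W := (stdOrthonormalBasis ℝ W).reindex (finCongr hWd)
  let L : EuclideanSpace ℝ (Fin d) →ₗᵢ[ℝ] Euc n :=
    W.subtypeₗᵢ.comp b.repr.symm.toLinearIsometry
  have hLW : ∀ y, L y ∈ W := fun y => (b.repr.symm y).2
  set f : Euc n → Euc n := fun q => W.starProjection (q - x) with hf
  have hflip : LipschitzWith 1 f := by
    refine LipschitzWith.of_dist_le_mul fun q q' => ?_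
    simp only [hf, dist_eq_norm, NNReal.coe_one, one_mul]
    rw [← map_sub, sub_sub_sub_cancel_right]
    exact W.norm_starProjection_apply_le _
  have hsub : L '' Metric.closedBall 0 ρ ⊆ f '' (M ∩ Metric.ball x ρ') := by
    rintro _ ⟨y, hy, rfl⟩
    have hyn : ‖L y‖ ≤ ρ := by rw [L.norm_map]; exact mem_closedBall_zero_iff.1 hy
    obtain ⟨p, hpM, hpx, hp⟩ := hM.exists_starProjection_eq hτ0 hτ hx hρ hW hκ (hLW y) hyn
    refine ⟨p, ⟨hpM, ?_⟩, hp⟩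
    rw [mem_ball_iff_norm]
    refine lt_of_le_of_lt ?_ hρ'
    have h1 := hM.norm_sub_starProjection_le_of_near_tangent hτ0 hτ hx hpM hW
    rw [hp] at h1
    have h2 : ‖p - x‖ ^ 2 / τ + κ * ‖p - x‖ ≤ (3 * ρ) ^ 2 / τ + κ * (3 * ρ) := by gcongr
    have h3 : (3 * ρ) ^ 2 / τ + κ * (3 * ρ) = ρ * (9 * (ρ / τ) + 3 * κ) := by ring
    have h4 := norm_le_norm_add_norm_sub' (p - x) (L y)
    linarith
  calc ENNReal.ofReal (ρ ^ d) * volume (Metric.ball (0 : EuclideanSpace ℝ (Fin d)) 1)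
      = volume (Metric.closedBall (0 : EuclideanSpace ℝ (Fin d)) ρ) := by
        rw [Measure.addHaar_closedBall _ _ hρ.le, finrank_euclideanSpace_fin]
    _ = μHE[d] (L '' Metric.closedBall 0 ρ) := by
        rw [L.isometry.euclideanHausdorffMeasure_image,
          EuclideanSpace.euclideanHausdorffMeasure_eq_volume]
    _ ≤ μHE[d] (f '' (M ∩ Metric.ball x ρ')) := measure_mono hsub
    _ ≤ μHE[d] (M ∩ Metric.ball x ρ') := by
        have h1 := (hflip.lipschitzOnWith (s := M ∩ Metric.ball x ρ')).hausdorffMeasure_image_le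
          (d := d) (by positivity)
        simp only [ENNReal.coe_one, ENNReal.one_rpow, one_mul] at h1
        rw [Measure.euclideanHausdorffMeasure_def, Measure.smul_apply, Measure.smul_apply]
        gcongr

/-- Balls of radius half the separation are disjoint, and each of them contains a part of `M` of
volume bounded below. -/
theorem card_le_of_separated {r : ℝ} (hr : 0 < r) {m : ℕ} (C : Fin m → Cylinder n d)
    (hCM : ∀ i, (C i).center ∈ M)
    (hsep : ∀ i j : Fin m, i ≠ j → r / 2.9 ≤ ‖(C i).center - (C j).center‖) {κ : ℝ}
    (hdir : ∀ i, ‖(C i).dir.starProjection -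
      (tangentSpaceOf M (C i).center).starProjection‖ ≤ κ)
    (hκ : 55 * (r / τ) + 3 * κ < 1) (hκ' : 3 / 2 * (r / τ) + 3 * κ ≤ 1 / 60) :
    (m : ℝ≥0∞) ≤ ENNReal.ofReal
      (6 ^ d / (volume (Metric.ball (0 : EuclideanSpace ℝ (Fin d)) 1)).toReal / r ^ d) *
        μHE[d] M := by
  set ω := volume (Metric.ball (0 : EuclideanSpace ℝ (Fin d)) 1) with hω
  have hωtop : ω ≠ ⊤ := measure_ball_lt_top.ne
  have hω0 : 0 < ω.toReal := ENNReal.toReal_pos (Metric.measure_ball_pos _ _ one_pos).ne' hωtop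
  have hball : ∀ i, ENNReal.ofReal ((r / 6) ^ d) * ω ≤
      μHE[d] (M ∩ Metric.ball (C i).center (r / 5.8)) := fun i => by
    refine hM.le_euclideanHausdorffMeasure_inter_ball hτ0 hτ (hCM i) (C i).finrank_dir
      (by positivity) (hdir i) ?_ ?_
    · have : 330 * (r / 6 / τ) = 55 * (r / τ) := by ring
      linarith
    · have h1 : 9 * (r / 6 / τ) = 3 / 2 * (r / τ) := by ring
      rw [h1, add_assoc]
      have h2 : r / 6 * (1 + (3 / 2 * (r / τ) + 3 * κ)) ≤ r / 6 * (1 + 1 / 60) := by gcongr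
      refine h2.trans_lt ?_
      norm_num
      linarith
  have hdisj : Pairwise (Function.onFun Disjoint
      fun i => M ∩ Metric.ball (C i).center (r / 5.8)) := by
    intro i j hij
    refine Disjoint.mono Set.inter_subset_right Set.inter_subset_right
      (Metric.ball_disjoint_ball ?_)
    rw [dist_eq_norm]
    refine le_trans (le_of_eq ?_) (hsep i j hij)
    ring
  have hsum : (m : ℝ≥0∞) * (ENNReal.ofReal ((r / 6) ^ d) * ω) ≤ μHE[d] M := by
    calc (m : ℝ≥0∞) * (ENNReal.ofReal ((r / 6) ^ d) * ω)
        = ∑ _i : Fin m, ENNReal.ofReal ((r / 6) ^ d) * ω := by simp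
      _ ≤ ∑ i : Fin m, μHE[d] (M ∩ Metric.ball (C i).center (r / 5.8)) :=
          Finset.sum_le_sum fun i _ => hball i
      _ = μHE[d] (⋃ i, M ∩ Metric.ball (C i).center (r / 5.8)) := by
          rw [measure_iUnion hdisj fun i => hM.1.measurableSet.inter measurableSet_ball,
            tsum_fintype]
      _ ≤ μHE[d] M := measure_mono (Set.iUnion_subset fun i => Set.inter_subset_left)
  have hinv : ENNReal.ofReal (6 ^ d / ω.toReal / r ^ d) * (ENNReal.ofReal ((r / 6) ^ d) * ω) = 1 := by
    nth_rewrite 2 [← ENNReal.ofReal_toReal hωtop]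
    rw [← ENNReal.ofReal_mul (by positivity), ← ENNReal.ofReal_mul (by positivity), div_pow,
      ← ENNReal.ofReal_one]
    congr 1
    field_simp
  calc (m : ℝ≥0∞) = ENNReal.ofReal (6 ^ d / ω.toReal / r ^ d) *
        (m * (ENNReal.ofReal ((r / 6) ^ d) * ω)) := by rw [mul_left_comm, hinv, mul_one]
    _ ≤ _ := by gcongr

end IsCompactImbeddedManifold

end Manifold

/-! ### Moving a cylinder onto its neighbour -/

namespace Cylinder

variable {n d : ℕ}

/-- Intersecting cylinders of size `r` have centers at distance at most `4 r`. -/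
theorem norm_center_sub_le {c c' : Cylinder n d} {r : ℝ}
    (h : (c.solid r ∩ c'.solid r).Nonempty) : ‖c.center - c'.center‖ ≤ 4 * r := by
  obtain ⟨p, hp, hp'⟩ := h
  have key : ∀ e : Cylinder n d, p ∈ e.solid r → ‖p - e.center‖ ≤ 2 * r := by
    rintro e ⟨h1, h2⟩
    have h3 := norm_le_norm_add_norm_sub' (p - e.center) (e.dir.starProjection (p - e.center))
    linarith
  have h1 : c.center - c'.center = (p - c'.center) - (p - c.center) := by abel
  rw [h1]
  have h2 := norm_sub_le (p - c'.center) (p - c.center)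
  linarith [key c hp, key c' hp']

/-- A rotation that carries the direction of `c` to that of `c'`, followed by a translation that
brings the center of `c` to `c'.center + w`, carries `c` to the translate of `c'` by `w`. -/
theorem move_image_solid (c c' : Cylinder n d) (R : Euc n ≃ₗᵢ[ℝ] Euc n)
    (hR : ∀ v, R (c.dir.starProjection v) = c'.dir.starProjection (R v)) (w : Euc n) (r : ℝ) :
    c.move R (c'.center + w - c.center) '' c.solid r = (fun v => v + w) '' c'.solid r := by
  have hmove : ∀ v, c.move R (c'.center + w - c.center) v = c'.center + R (v - c.center) + w := by
    intro v; simp only [move]; abel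
  have hsolid : ∀ v, v ∈ c.solid r ↔ c'.center + R (v - c.center) ∈ c'.solid r := by
    intro v
    simp only [solid, Set.mem_ofPred_eq, add_sub_cancel_left]
    rw [← hR, ← map_sub, R.norm_map, R.norm_map]
  ext p
  constructor
  · rintro ⟨v, hv, rfl⟩
    exact ⟨_, (hsolid v).1 hv, (hmove v).symm⟩
  · rintro ⟨v, hv, rfl⟩
    have h1 : c'.center + R ((c.center + R.symm (v - c'.center)) - c.center) = v := by
      rw [add_sub_cancel_left, R.apply_symm_apply]; abel
    refine ⟨c.center + R.symm (v - c'.center), (hsolid _).2 (by rwa [h1]), ?_⟩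
    rw [hmove, h1]

end Cylinder

/-! ### Admissible packets -/

theorem mainTheorem6 (d : ℕ) (K : ℝ) :
    ∃ c A : ℝ, 0 < c ∧ 0 < A ∧
      ∀ (n : ℕ) (M : Set (Euc n)), IsCompactImbeddedManifold d M →
      ∀ τ : ℝ, 0 < τ → ENNReal.ofReal τ ≤ reach M →
      ∀ r : ℝ, 0 < r → r ≤ c * τ →
      ∀ (m : ℕ) (C : Fin m → Cylinder n d),
        IsNetFor (r / 2) (Set.range fun i => (C i).center) M →
        (∀ i j : Fin m, i ≠ j → r / 2.9 ≤ ‖(C i).center - (C j).center‖) →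
        (∀ i : Fin m, ‖(C i).dir.starProjection -
          (tangentSpaceOf M (C i).center).starProjection‖ ≤ K * (r / τ)) →
        IsCylinderPacket A (μHE[d] M) τ r C := by
  -- `L` replaces a possibly negative `K`
  set L := max K 0 with hL
  have hL0 : 0 ≤ L := le_max_right _ _
  set ω := (volume (Metric.ball (0 : EuclideanSpace ℝ (Fin d)) 1)).toReal with hω
  have hω0 : 0 ≤ 6 ^ d / ω := div_nonneg (by positivity) ENNReal.toReal_nonneg
  -- The three terms of `A` serve the rotations (intersecting cylinders have centers at distance at
  -- most `4 r`, and `110 * 4 = 440`), the translations, and the number of cylinders; `c` is small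
  -- enough for all error terms, the tightest being `‖P_{W_j} - P_{W_i}‖ < 1`.
  refine ⟨1 / (1000 * (1 + L)), 441 + 6 * L + 6 ^ d / ω, by positivity, by positivity, ?_⟩
  intro n M hM τ hτ0 hτ r hr hrτ m C hnet hsep hdir
  set A := 441 + 6 * L + 6 ^ d / ω with hA
  set θ := r / τ with hθ
  have hθ0 : 0 < θ := div_pos hr hτ0
  have hθ1 : θ * (1 + L) ≤ 1 / 1000 := by
    have h1 : θ ≤ 1 / (1000 * (1 + L)) := by rw [hθ, div_le_iff₀ hτ0]; exact hrτ
    rw [le_div_iff₀ (by positivity)] at h1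
    linarith
  set κ := L * θ with hκ
  have hκ0 : 0 ≤ κ := by positivity
  have hθκ : θ + κ ≤ 1 / 1000 := by rw [hκ]; linarith
  have hdir' : ∀ i, ‖(C i).dir.starProjection -
      (tangentSpaceOf M (C i).center).starProjection‖ ≤ κ := fun i =>
    (hdir i).trans (by rw [hκ]; gcongr; exact le_max_left _ _)
  have hCM : ∀ i, (C i).center ∈ M := fun i => hnet.1 ⟨i, rfl⟩
  have hrθ : r = θ * τ := by rw [hθ, div_mul_cancel₀ _ hτ0.ne']
  -- the distance of a point of `M` near a center from the plane of the cylinder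
  have hnormal : ∀ i, ∀ q ∈ M, ∀ a : ℝ, ‖q - (C i).center‖ ≤ a * r →
      ‖(q - (C i).center) - (C i).dir.starProjection (q - (C i).center)‖ ≤
        (a * θ + κ) * ‖q - (C i).center‖ := by
    intro i q hq a ha
    refine (hM.norm_sub_starProjection_le_of_near_tangent hτ0 hτ (hCM i) hq (hdir' i)).trans ?_
    have h1 : ‖q - (C i).center‖ ^ 2 / τ ≤ a * θ * ‖q - (C i).center‖ := by
      rw [div_le_iff₀ hτ0, sq]
      calc _ ≤ a * r * ‖q - (C i).center‖ := by gcongr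
        _ = _ := by rw [hrθ]; ring
    linarith
  refine ⟨?_, fun i => ?_⟩
  · refine (hM.card_le_of_separated hτ0 hτ hr C hCM hsep hdir' (by linarith) (by linarith)).trans ?_
    gcongr
    rw [hA]
    linarith
  · have hnear : ∀ j ∈ intersecting r C i, ‖(C j).center - (C i).center‖ ≤ 4 * r :=
      fun j hj => Cylinder.norm_center_sub_le hj.2
    have hrot : ∀ j, ∃ R : Euc n ≃ₗᵢ[ℝ] Euc n, j ∈ intersecting r C i →
        LinearMap.det (R.toLinearEquiv : Euc n →ₗ[ℝ] Euc n) = 1 ∧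
        (∀ v, R ((C j).dir.starProjection v) = (C i).dir.starProjection (R v)) ∧
        ∀ v, ‖R v - v‖ ≤ 2 * ((440 + 2 * L) * θ) * ‖v‖ := by
      intro j
      by_cases hj : j ∈ intersecting r C i
      · have h1 := hnear j hj
        have h2 : ‖(C j).center - (C i).center‖ / τ ≤ 4 * θ := by
          rw [hθ, ← mul_div_assoc]; gcongr
        have h3 : ‖(C j).center - (C i).center‖ ≤ τ := by
          rw [← div_le_one hτ0]; linarith
        have h4 := hM.norm_starProjection_tangent_sub_le hτ0 hτ (hCM j) (hCM i) h3
        have h5 : ‖(C j).dir.starProjection - (C i).dir.starProjection‖ ≤ (440 + 2 * L) * θ := by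
          have h6 := hdir' i
          rw [norm_sub_rev] at h6
          have h7 : (C j).dir.starProjection - (C i).dir.starProjection =
              ((C j).dir.starProjection - (tangentSpaceOf M (C j).center).starProjection) +
              ((tangentSpaceOf M (C j).center).starProjection -
                (tangentSpaceOf M (C i).center).starProjection) +
              ((tangentSpaceOf M (C i).center).starProjection - (C i).dir.starProjection) := by
            abel
          rw [h7]
          refine norm_add₃_le.trans ?_
          have h8 : (440 + 2 * L) * θ = 440 * θ + 2 * κ := by rw [hκ]; ring
          linarith [hdir' j]
        have h9 : (440 + 2 * L) * θ < 1 := by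
          have : (440 + 2 * L) * θ = 440 * θ + 2 * κ := by rw [hκ]; ring
          linarith
        obtain ⟨R, hR⟩ := Submodule.exists_rotation_of_norm_starProjection_sub_le _ _ h9 h5
        exact ⟨R, fun _ => hR⟩
      · exact ⟨LinearIsometryEquiv.refl ℝ _, fun h => absurd h hj⟩
    choose R hR using hrot
    set P := (C i).dir.starProjection with hP
    -- the moved centers are the projections of the centers to the plane of the `i`-th cylinder
    set w : Fin m → Euc n := fun j => P ((C j).center - (C i).center) with hw
    set t : Fin m → Euc n := fun j => (C i).center + w j - (C j).center with ht
    have hcenter : ∀ j, (C j).move (R j) (t j) (C j).center = (C i).center + w j := by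
      intro j
      simp only [Cylinder.move, sub_self, map_zero, ht]; abel
    refine ⟨R, t, fun j hj => (hR j hj).1, fun j hj => ⟨w j, ?_, ?_⟩, ⟨?_, ?_⟩, ?_, ?_⟩
    · have h1 := hnormal i _ (hCM j) 4 (hnear j hj)
      have h2 := norm_le_norm_add_norm_sub' ((C j).center - (C i).center) (w j)
      have h3 := hsep j i hj.1
      have h4 : r / 2.9 * (29 / 30) ≤ ‖(C j).center - (C i).center‖ * (1 - (4 * θ + κ)) := by
        gcongr
        linarith
      have h5 : r / 2.9 * (29 / 30) = r / 3 := by ring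
      have h6 : ‖(C j).center - (C i).center - w j‖ ≤
          (4 * θ + κ) * ‖(C j).center - (C i).center‖ := h1
      linarith
    · exact (C j).move_image_solid (C i) (R j) (hR j hj).2.1 (w j) r
    · refine Set.insert_subset (by simp [Cylinder.plane]) ?_
      rintro _ ⟨j, -, rfl⟩
      dsimp only
      rw [hcenter]
      simp only [Cylinder.plane, Set.mem_ofPred_eq, add_sub_cancel_left]
      exact Submodule.starProjection_apply_mem _ _
    · rintro q ⟨hqW, hqr⟩
      obtain ⟨p, hpM, hpx, hp⟩ := hM.exists_starProjection_eq hτ0 hτ (hCM i) hr (hdir' i)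
        (by linarith) hqW hqr
      obtain ⟨_, ⟨j, rfl⟩, hj⟩ := hnet.2 p hpM
      dsimp only at hj
      -- `q` and the moved `j`-th center are the projections of `p` and of the `j`-th center
      have hproj : ‖q - ((C i).center + w j)‖ < r / 2 := by
        have h1 : q - ((C i).center + w j) = P (p - (C j).center) := by
          have h2 : p - (C j).center = (p - (C i).center) - ((C j).center - (C i).center) := by abel
          rw [h2, map_sub, hp]
          simp only [hw]
          abel
        rw [h1]
        exact (Submodule.norm_starProjection_apply_le _ _).trans_lt hj
      by_cases hji : j = i
      · refine ⟨(C i).center, Set.mem_insert _ _, ?_⟩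
        simpa [hji, hw] using hproj
      · refine ⟨(C i).center + w j, Set.mem_insert_of_mem _ ⟨j, ⟨hji, p, ?_, ?_⟩, hcenter j⟩, hproj⟩
        · refine ⟨(Submodule.norm_starProjection_apply_le _ _).trans (by linarith), ?_⟩
          rw [← Submodule.starProjection_orthogonal_val]
          exact (Submodule.norm_starProjection_apply_le _ _).trans (by linarith)
        · refine ⟨by rw [hp]; exact hqr, (hnormal i p hpM 3 hpx).trans ?_⟩
          calc (3 * θ + κ) * ‖p - (C i).center‖ ≤ (1 / 3) * (3 * r) := by
                gcongr; linarith
            _ = r := by ring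
    · intro j hj v hv
      have hvn : 0 < ‖v - (C j).center‖ := norm_pos_iff.2 (sub_ne_zero.2 hv)
      have h1 := (hR j hj).2.2 (v - (C j).center)
      have h2 : v - (C j).move (R j) 0 v =
          -(R j (v - (C j).center) - (v - (C j).center)) := by
        simp only [Cylinder.move]; abel
      rw [h2, norm_neg]
      refine h1.trans_lt ?_
      have h3 : 2 * ((440 + 2 * L) * θ) * ‖v - (C j).center‖ =
          (440 + 2 * L) * (2 * θ * ‖v - (C j).center‖) := by ring
      rw [h3]
      gcongr
      rw [hA]
      linarith
    · intro j hj
      have h1 : ‖t j‖ = ‖((C j).center - (C i).center) - w j‖ := by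
        rw [← norm_neg]; congr 1; simp only [ht]; abel
      rw [h1]
      have h2 : r ^ 2 / τ = θ * r := by rw [hθ]; ring
      rw [h2]
      calc ‖((C j).center - (C i).center) - w j‖
          ≤ (4 * θ + κ) * ‖(C j).center - (C i).center‖ := hnormal i _ (hCM j) 4 (hnear j hj)
        _ ≤ (4 * θ + κ) * (4 * r) := by gcongr; exact hnear j hj
        _ = (16 + 4 * L) * (θ * r) := by rw [hκ]; ring
        _ < A * (θ * r) := by
          gcongr
          rw [hA]
          linarith
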